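/- Let $n\ge 1$, let $\mathcal M=\mathbb H^n$ be hyperbolic space (the unit ball of $\mathbb R^n$ with the Riemannian metric $g_x = 4\,|dx|^2/(1-|x|^2)^2$, with Riemannian distance $d$) and let $\mathcal N=\{p\}$ with $p\in\mathbb H^n$. The condition metric on $\mathcal M\setminus\mathcal N$ is $g_{x,\kappa}=d(x,\mathcal N)^{-2}g_x$. A minimizing geodesic of the condition metric is a Lipschitz curve $\gamma:[a,b]\to\mathcal M\setminus\mathcal N$, $a<b$, parametrized by $g_\kappa$-arc length, whose $g_\kappa$-length is at most that of any Lipschitz curve $[a,b]\to\mathcal M\setminus\mathcal N$ with the same endpoints; a geodesic of the condition metric is a curve $\gamma:I\to\mathcal M\setminus\mathcal N$ on an interval $I$ that is locally a minimizing geodesic. Then for every geodesic $\gamma: I\to\mathcal M\setminus\mathcal N$ of the condition metric: 1. the function $F(t)=\log\frac{1}{d(\gamma(t),\mathcal N)}$ is concave on $I$; 2. $\gamma$ is differentiable on $I$, $F$ is $\mathcal C^2$ on $I$ (one-sidedly at endpoints belonging to $I$), and for every $t\in I$ such that $\gamma'(t)$ is not tangent to the hyperbolic geodesic segment joining $\gamma(t)$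 to $p$ (that is, $\gamma'(t)$ points neither towards $p$ nor away from $p$), $F$ is strictly concave at $t$: $F''(t)<0$, and $F$ is strictly concave on a neighbourhood of $t$ in $I$. Moreover, if $n\ge 2$, then the self-convexity property fails for $(\mathbb H^n,\{p\})$: it is not true that $t\mapsto\log\frac{1}{d(\gamma(t),\mathcal N)}$ is convex for every geodesic $\gamma$ of the condition metric. -/

import Mathlib

open Set Topology

namespace ConditionMetric

/-- The underlying Euclidean space of the ball model in dimension `n`. -/
abbrev E (n : ℕ) : Type := EuclideanSpace ℝ (Fin n)

/-! ### Curves and geodesics of a conformally Euclidean metric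

`w : E n → ℝ` is the conformal factor: the metric at `x` is `(w x) ^ 2` times the Euclidean inner
product, so a tangent vector `v` at `x` has norm `w x * ‖v‖`. -/

/-- A Lipschitz curve `[a, b] → M`. (The image is compact, so for an `M` contained in the domain
of a continuous conformal metric this does not depend on the metric used.) -/
def IsLipschitzCurve {n : ℕ} (M : Set (E n)) (c : ℝ → E n) (a b : ℝ) : Prop :=
  (∃ K : NNReal, LipschitzOnWith K c (Icc a b)) ∧ MapsTo c (Icc a b) M

/-- The length of the curve `c` on `[a, b]` for the metric with conformal factor `w`. -/
noncomputable def length {n : ℕ} (w : E n → ℝ) (c : ℝ → E n) (a b : ℝ) : ℝ :=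
  ∫ t in a..b, w (c t) * ‖deriv c t‖

/-- The Riemannian distance in `M` for the metric with conformal factor `w`: the infimum of the
lengths of the curves in `M` from `x` to `y`. -/
noncomputable def riemDist {n : ℕ} (w : E n → ℝ) (M : Set (E n)) (x y : E n) : ℝ :=
  sInf {L : ℝ | ∃ c : ℝ → E n, IsLipschitzCurve M c 0 1 ∧ c 0 = x ∧ c 1 = y ∧ L = length w c 0 1}

/-- `γ : [a, b] → M` is a minimizing geodesic: a Lipschitz curve, parametrized by arc length,
that is not longer than any Lipschitz curve `[a, b] → M` with the same endpoints. -/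
structure IsMinimizingGeodesic {n : ℕ} (w : E n → ℝ) (M : Set (E n)) (γ : ℝ → E n) (a b : ℝ) :
    Prop where
  lt : a < b
  curve : IsLipschitzCurve M γ a b
  arcLength : ∀ s t : ℝ, a ≤ s → s ≤ t → t ≤ b → length w γ s t = t - s
  minimizing : ∀ c : ℝ → E n, IsLipschitzCurve M c a b → c a = γ a → c b = γ b →
    length w γ a b ≤ length w c a b

/-- `γ : I → M`, with `I` an interval, is a geodesic: near every point of `I` it is a minimizing
geodesic. -/
def IsGeodesicOn {n : ℕ} (w : E n → ℝ) (M : Set (E n)) (γ : ℝ → E n) (I : Set ℝ) : Prop :=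
  I.OrdConnected ∧ ∀ t ∈ I, ∃ a b : ℝ, t ∈ Icc a b ∧ Icc a b ⊆ I ∧ Icc a b ∈ 𝓝[I] t ∧
    IsMinimizingGeodesic w M γ a b

/-! ### Hyperbolic space (Poincaré ball model) -/

/-- The points of `n`-dimensional hyperbolic space. -/
def hypSpace (n : ℕ) : Set (E n) := Metric.ball 0 1

/-- The conformal factor of the hyperbolic metric `4 |dx|² / (1 - |x|²)²`. -/
noncomputable def hypFactor {n : ℕ} (x : E n) : ℝ := 2 / (1 - ‖x‖ ^ 2)

/-- The hyperbolic distance. -/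
noncomputable def hypDist {n : ℕ} (x y : E n) : ℝ := riemDist hypFactor (hypSpace n) x y

/-- The hyperbolic distance `d(x, N)` from `x` to a (nonempty) set `N`. -/
noncomputable def distTo {n : ℕ} (N : Set (E n)) (x : E n) : ℝ := ⨅ y : N, hypDist x y

/-- `v`, a tangent vector at `x`, is tangent to the hyperbolic geodesic segment `σ` that joins
`x` to `p` (it points towards `p`, or away from it, or is zero). -/
def IsRadial {n : ℕ} (p x v : E n) : Prop :=
  ∃ (σ : ℝ → E n) (l : ℝ) (u : E n), IsMinimizingGeodesic hypFactor (hypSpace n) σ 0 l ∧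
    σ 0 = x ∧ σ l = p ∧ HasDerivWithinAt σ u (Icc 0 l) 0 ∧ ∃ k : ℝ, v = k • u

/-! ### The condition metric of a subset `N` of hyperbolic space -/

/-- The conformal factor of the condition metric `d(x, N)⁻² g_x`, with `g` the hyperbolic
metric. -/
noncomputable def condFactor {n : ℕ} (N : Set (E n)) (x : E n) : ℝ :=
  (distTo N x)⁻¹ * hypFactor x

/-- `γ : I → ℍⁿ \ N` is a geodesic of the condition metric. -/
def IsCondGeodesic {n : ℕ} (N : Set (E n)) (γ : ℝ → E n) (I : Set ℝ) : Prop :=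
  IsGeodesicOn (condFactor N) (hypSpace n \ N) γ I

/-- The function `t ↦ log (1 / d(γ(t), N))`. -/
noncomputable def logInvDist {n : ℕ} (N : Set (E n)) (γ : ℝ → E n) (t : ℝ) : ℝ :=
  Real.log (1 / distTo N (γ t))

/-- The self-convexity property: `t ↦ log (1 / d(γ(t), N))` is convex for every geodesic `γ` of
the condition metric. -/
def SelfConvex {n : ℕ} (N : Set (E n)) : Prop :=
  ∀ (γ : ℝ → E n) (I : Set ℝ), IsCondGeodesic N γ I → ConvexOn ℝ I (logInvDist N γ)

end ConditionMetric

/-!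
For `p = 0`, in logarithmic polar coordinates `s = log (1 / d(x, 0))` and `θ = x / ‖x‖`, the
condition metric is the warped product `ds² + f(s)² |dθ|²` of a line and the unit sphere, with
`f(s) = sinh r / r` and `r = exp (-s)` (`condSpeed_polarCurve_sq`). The function of the theorem is
the coordinate `s` itself, and the geodesic equation for it reads `s'' = f(s) f'(s) |θ'|²`. As
`sinh r / r` increases with `r`, we have `f' < 0` (`deriv_warp_neg`), so `s` is concave, strictly so
where `θ' ≠ 0`, that is, where the geodesic does not move radially.

Geodesics are given only as Lipschitz minimizers of length, so the geodesic equation needs a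
regularity argument. A unit speed minimizer of the length also minimizes the energy. Varying `s` and
applying the lemma of du Bois-Reymond (`exists_eq_const_add_integral`) gives the equation for `s` in
integrated form. Varying `θ` by infinitesimal rotations shows that the angular momenta
`f(s)² (θᵢ θⱼ' - θⱼ θᵢ')` are constant almost everywhere, and since `θ` is a unit vector they
determine `θ'` as a continuous function of `(s, θ)`. Together these give
`IsEnergyMinimizer.exists_hasDerivWithinAt`.

An inversion in a sphere orthogonal to the unit sphere is a hyperbolic isometry, and moves any point
`p` of the ball to the centre (`exists_isHypInvolution`), so the case `p = 0` suffices.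

Self-convexity fails as soon as there is one non-radial geodesic. One with angular momentum `1` is
obtained from the equations `s' = √(1 - 1 / f(s)²)` and `α' = 1 / f(s)²` for the angle `α` in a
plane. A short arc of it is minimizing because the function `g(s) + arcsin ⟪e, θ⟫`, with
`g' = √(1 - 1 / f²)`, grows at most at unit speed along every short curve with the same starting
point and exactly at unit speed along this one (`calibration_le_length`).
-/

namespace ConditionMetric

open MeasureTheory Filter

/-! ### Calculus of Lipschitz curves on a compact interval -/

section Lipschitz

variable {V W : Type*} [NormedAddCommGroup V] [NormedAddCommGroup W]

/-- `c` is Lipschitz on `[a, b]`, with an unspecified constant. -/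
def LipOn (c : ℝ → V) (a b : ℝ) : Prop := ∃ K : NNReal, LipschitzOnWith K c (Icc a b)

theorem LipOn.mono {c : ℝ → V} {a b a' b' : ℝ} (h : LipOn c a b) (ha : a ≤ a') (hb : b' ≤ b) :
    LipOn c a' b' :=
  h.imp fun _ hK => hK.mono (Icc_subset_Icc ha hb)

theorem LipOn.continuousOn {c : ℝ → V} {a b : ℝ} (h : LipOn c a b) : ContinuousOn c (Icc a b) :=
  h.choose_spec.continuousOn

theorem LipOn.prodMk {c : ℝ → V} {d : ℝ → W} {a b : ℝ} (hc : LipOn c a b) (hd : LipOn d a b) :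
    LipOn (fun t => (c t, d t)) a b := by
  obtain ⟨K, hK⟩ := hc
  obtain ⟨K', hK'⟩ := hd
  exact ⟨max K K', hK.prodMk hK'⟩

theorem LipOn.const (v : V) (a b : ℝ) : LipOn (fun _ => v) a b :=
  ⟨0, LipschitzWith.const v |>.lipschitzOnWith⟩

theorem LipOn.absolutelyContinuousOnInterval {c : ℝ → V} {a b : ℝ} (hab : a ≤ b)
    (hc : LipOn c a b) : AbsolutelyContinuousOnInterval c a b := by
  obtain ⟨K, hK⟩ := hc
  exact LipschitzOnWith.absolutelyContinuousOnInterval (K := K) (by rwa [uIcc_of_le hab])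

variable [NormedSpace ℝ V] [NormedSpace ℝ W]

/-- A `C¹` function of a Lipschitz curve is Lipschitz, because the curve is compact. -/
theorem LipOn.comp_contDiffAt {c : ℝ → V} {a b : ℝ} (hc : LipOn c a b) {g : V → W}
    (hg : ∀ t ∈ Icc a b, ContDiffAt ℝ 1 g (c t)) : LipOn (fun t => g (c t)) a b := by
  obtain ⟨K, hK⟩ := hc
  refine LocallyLipschitzOn.exists_lipschitzOnWith_of_compact isCompact_Icc ?_
  intro t ht
  obtain ⟨K', s, hs, hgs⟩ := (hg t ht).exists_lipschitzOnWith
  refine ⟨K' * K, Icc a b ∩ c ⁻¹' s, ?_, ?_⟩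
  · exact Filter.inter_mem self_mem_nhdsWithin (hK.continuousOn t ht hs)
  · exact hgs.comp (hK.mono inter_subset_left) fun x hx => hx.2

theorem LipOn.comp_contDiff {c : ℝ → V} {a b : ℝ} (hc : LipOn c a b) {g : V → W}
    (hg : ContDiff ℝ 1 g) : LipOn (fun t => g (c t)) a b :=
  hc.comp_contDiffAt fun _ _ => hg.contDiffAt

theorem LipOn.add {c d : ℝ → V} {a b : ℝ} (hc : LipOn c a b) (hd : LipOn d a b) :
    LipOn (fun t => c t + d t) a b :=
  (hc.prodMk hd).comp_contDiff (g := fun x => x.1 + x.2) (by fun_prop)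

theorem LipOn.smul {c : ℝ → ℝ} {d : ℝ → V} {a b : ℝ} (hc : LipOn c a b) (hd : LipOn d a b) :
    LipOn (fun t => c t • d t) a b :=
  (hc.prodMk hd).comp_contDiff (g := fun x => x.1 • x.2) (by fun_prop)

theorem LipOn.exists_norm_deriv_le {c : ℝ → V} {a b : ℝ} (hc : LipOn c a b) :
    ∃ C, ∀ t ∈ Ioo a b, ‖deriv c t‖ ≤ C := by
  obtain ⟨K, hK⟩ := hc
  exact ⟨K, fun t ht => norm_deriv_le_of_lipschitzOn (Icc_mem_nhds ht.1 ht.2) hK⟩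

theorem ae_mem_Ioo (a b : ℝ) : ∀ᵐ t ∂(volume.restrict (Ioc a b)), t ∈ Ioo a b := by
  rw [← Measure.restrict_congr_set (Ioo_ae_eq_Ioc (a := a) (b := b))]
  exact ae_restrict_mem measurableSet_Ioo

theorem LipOn.ae_hasDerivAt [FiniteDimensional ℝ V] {c : ℝ → V} {a b : ℝ} (hc : LipOn c a b) :
    ∀ᵐ t ∂(volume.restrict (Ioc a b)), HasDerivAt c (deriv c t) t := by
  obtain ⟨K, hK⟩ := hc
  filter_upwards [ae_mem_Ioo a b, ae_restrict_of_ae hK.ae_differentiableWithinAt_of_mem_real]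
    with t ht h
  exact ((h (Ioo_subset_Icc_self ht)).differentiableAt (Icc_mem_nhds ht.1 ht.2)).hasDerivAt

theorem LipOn.integral_deriv {c : ℝ → ℝ} {a b : ℝ} (hab : a ≤ b) (hc : LipOn c a b) :
    ∫ t in a..b, deriv c t = c b - c a :=
  (hc.absolutelyContinuousOnInterval hab).integral_deriv_eq_sub

/-- A curve whose increments are dominated near `t` by those of another one has the smaller
speed at `t`. -/
theorem norm_deriv_le_of_dist_le {c : ℝ → V} {d : ℝ → W} {c' : V} {d' : W} {t : ℝ}
    (hc : HasDerivAt c c' t) (hd : HasDerivAt d d' t)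
    (h : ∀ᶠ x in 𝓝 t, ‖c x - c t‖ ≤ ‖d x - d t‖) : ‖c'‖ ≤ ‖d'‖ := by
  have h1 := (hasDerivAt_iff_tendsto_slope.1 hc).norm
  have h2 := (hasDerivAt_iff_tendsto_slope.1 hd).norm
  refine le_of_tendsto_of_tendsto h1 h2 ?_
  filter_upwards [mem_nhdsWithin_of_mem_nhds h] with x hx
  simp only [slope, vsub_eq_sub, norm_smul]
  gcongr

theorem inner_deriv_eq_zero_of_norm_eq_one {V : Type*} [NormedAddCommGroup V]
    [InnerProductSpace ℝ V] {θ : ℝ → V} {θ' : V} {t : ℝ} (hθ : HasDerivAt θ θ' t)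
    (h : ∀ᶠ x in 𝓝 t, ‖θ x‖ = 1) : inner ℝ (θ t) θ' = 0 := by
  have h2 : HasDerivAt (fun t => ‖θ t‖ ^ 2) (2 * inner ℝ (θ t) θ') t := hθ.norm_sq
  have h3 : (fun t => ‖θ t‖ ^ 2) =ᶠ[𝓝 t] fun _ => 1 := by
    filter_upwards [h] with x hx
    rw [hx, one_pow]
  have h4 := h2.unique ((hasDerivAt_const t (1 : ℝ)).congr_of_eventuallyEq h3)
  linarith

end Lipschitz

/-! ### Bounded measurable functions and the lemma of du Bois-Reymond -/

/-- `g` is measurable and essentially bounded on `(a, b]`. -/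
def EssBdd (g : ℝ → ℝ) (a b : ℝ) : Prop :=
  AEStronglyMeasurable g (volume.restrict (Ioc a b)) ∧
    ∃ C, ∀ᵐ t ∂(volume.restrict (Ioc a b)), ‖g t‖ ≤ C

namespace EssBdd

variable {g h : ℝ → ℝ} {a b : ℝ}

theorem add (hg : EssBdd g a b) (hh : EssBdd h a b) : EssBdd (fun t => g t + h t) a b := by
  obtain ⟨mg, C, hC⟩ := hg
  obtain ⟨mh, D, hD⟩ := hh
  refine ⟨mg.add mh, C + D, ?_⟩
  filter_upwards [hC, hD] with t h1 h2
  exact (norm_add_le _ _).trans (add_le_add h1 h2)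

theorem mul (hg : EssBdd g a b) (hh : EssBdd h a b) : EssBdd (fun t => g t * h t) a b := by
  obtain ⟨mg, C, hC⟩ := hg
  obtain ⟨mh, D, hD⟩ := hh
  refine ⟨mg.mul mh, C * D, ?_⟩
  filter_upwards [hC, hD] with t h1 h2
  rw [norm_mul]
  exact mul_le_mul h1 h2 (norm_nonneg _) ((norm_nonneg _).trans h1)

theorem const (r a b : ℝ) : EssBdd (fun _ => r) a b :=
  ⟨aestronglyMeasurable_const, ‖r‖, by simp⟩

theorem neg (hg : EssBdd g a b) : EssBdd (fun t => -g t) a b := by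
  simpa using (const (-1) a b).mul hg

theorem sub (hg : EssBdd g a b) (hh : EssBdd h a b) : EssBdd (fun t => g t - h t) a b := by
  simpa [sub_eq_add_neg] using hg.add hh.neg

theorem pow_two (hg : EssBdd g a b) : EssBdd (fun t => g t ^ 2) a b := by
  simpa [sq] using hg.mul hg

theorem of_continuousOn (hg : ContinuousOn g (Icc a b)) : EssBdd g a b := by
  obtain ⟨C, hC⟩ := isCompact_Icc.exists_bound_of_continuousOn hg
  refine ⟨(hg.mono Ioc_subset_Icc_self).aestronglyMeasurable measurableSet_Ioc, C, ?_⟩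
  filter_upwards [ae_mem_Ioo a b] with t ht
  exact hC t (Ioo_subset_Icc_self ht)

theorem inner_deriv {V : Type*} [NormedAddCommGroup V] [InnerProductSpace ℝ V]
    [FiniteDimensional ℝ V] {c : ℝ → V} {d : ℝ → V} (hc : LipOn c a b)
    (hd : ContinuousOn d (Icc a b)) : EssBdd (fun t => inner ℝ (d t) (deriv c t)) a b := by
  obtain ⟨C, hC⟩ := hc.exists_norm_deriv_le
  obtain ⟨D, hD⟩ := isCompact_Icc.exists_bound_of_continuousOn hd
  refine ⟨((hd.mono Ioc_subset_Icc_self).aestronglyMeasurable measurableSet_Ioc).inner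
    (aestronglyMeasurable_deriv c _), D * C, ?_⟩
  filter_upwards [ae_mem_Ioo a b] with t ht
  have h1 := hC t ht
  have h2 := hD t (Ioo_subset_Icc_self ht)
  exact (norm_inner_le_norm _ _).trans
    (mul_le_mul h2 h1 (norm_nonneg _) ((norm_nonneg _).trans h2))

theorem norm_deriv {V : Type*} [NormedAddCommGroup V] [NormedSpace ℝ V]
    [FiniteDimensional ℝ V] {c : ℝ → V} (hc : LipOn c a b) :
    EssBdd (fun t => ‖deriv c t‖) a b := by
  obtain ⟨C, hC⟩ := hc.exists_norm_deriv_le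
  refine ⟨(aestronglyMeasurable_deriv c _).norm, C, ?_⟩
  filter_upwards [ae_mem_Ioo a b] with t ht
  simpa using hC t ht

theorem deriv {c : ℝ → ℝ} (hc : LipOn c a b) : EssBdd (deriv c) a b := by
  obtain ⟨C, hC⟩ := hc.exists_norm_deriv_le
  refine ⟨aestronglyMeasurable_deriv c _, C, ?_⟩
  filter_upwards [ae_mem_Ioo a b] with t ht
  exact hC t ht

theorem intervalIntegrable (hab : a ≤ b) (hg : EssBdd g a b) :
    IntervalIntegrable g volume a b := by
  rw [intervalIntegrable_iff_integrableOn_Ioc_of_le hab]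
  obtain ⟨mg, C, hC⟩ := hg
  exact Integrable.of_bound mg C hC

theorem lipOn_integral (hab : a ≤ b) (hg : EssBdd g a b) :
    LipOn (fun t => ∫ x in a..t, g x) a b := by
  have hi := hg.intervalIntegrable hab
  obtain ⟨mg, C, hC⟩ := hg
  refine ⟨⟨max C 0, le_max_right _ _⟩, LipschitzOnWith.of_dist_le_mul fun x hx y hy => ?_⟩
  have hsub : ∀ z ∈ Icc a b, IntervalIntegrable g volume a z := fun z hz =>
    hi.mono_set (by rw [uIcc_of_le hz.1, uIcc_of_le hab]; exact Icc_subset_Icc_right hz.2)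
  rw [Real.dist_eq, intervalIntegral.integral_interval_sub_left (hsub x hx) (hsub y hy),
    Real.dist_eq]
  have := intervalIntegral.norm_integral_le_of_norm_le_const_ae (a := y) (b := x) (f := g)
    (C := max C 0) ?_
  · exact this
  · rw [ae_restrict_iff' measurableSet_Ioc] at hC
    filter_upwards [hC] with t ht h
    refine (ht ?_).trans (le_max_left _ _)
    exact ⟨(le_min hy.1 hx.1).trans_lt h.1, h.2.trans (max_le hy.2 hx.2)⟩

theorem ae_hasDerivAt_integral (hab : a ≤ b) (hg : EssBdd g a b) :
    ∀ᵐ t ∂(volume.restrict (Ioc a b)), HasDerivAt (fun t => ∫ x in a..t, g x) (g t) t := by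
  filter_upwards [ae_mem_Ioo a b,
    ae_restrict_of_ae (hg.intervalIntegrable hab).ae_hasDerivAt_integral] with t ht h
  exact h (by rw [uIcc_of_le hab]; exact Ioo_subset_Icc_self ht) a left_mem_uIcc

end EssBdd

theorem intervalIntegral_congr_ae_restrict {g h : ℝ → ℝ} {a b : ℝ} (hab : a ≤ b)
    (hgh : ∀ᵐ t ∂(volume.restrict (Ioc a b)), g t = h t) :
    ∫ t in a..b, g t = ∫ t in a..b, h t := by
  rw [intervalIntegral.integral_of_le hab, intervalIntegral.integral_of_le hab]
  exact integral_congr_ae hgh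

/-- The lemma of du Bois-Reymond for Lipschitz test functions. -/
theorem exists_eq_const_add_integral {g h : ℝ → ℝ} {a b : ℝ} (hab : a < b) (hg : EssBdd g a b)
    (hh : EssBdd h a b)
    (H : ∀ φ : ℝ → ℝ, LipOn φ a b → φ a = 0 → φ b = 0 →
      ∫ t in a..b, (g t * deriv φ t + h t * φ t) = 0) :
    ∃ A, ∀ᵐ t ∂(volume.restrict (Ioc a b)), g t = A + ∫ x in a..t, h x := by
  set P : ℝ → ℝ := fun t => ∫ x in a..t, h x with hP
  have hPL : LipOn P a b := hh.lipOn_integral hab.le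
  have hk : EssBdd (fun t => g t - P t) a b := hg.sub (.of_continuousOn hPL.continuousOn)
  set m : ℝ := (∫ t in a..b, (g t - P t)) / (b - a) with hm
  have hba : b - a ≠ 0 := (sub_pos.2 hab).ne'
  have hψ : EssBdd (fun t => g t - P t - m) a b := hk.sub (.const m a b)
  -- The test function is the primitive of `g - P - m`, with `m` the mean value of `g - P`.
  set φ : ℝ → ℝ := fun t => ∫ x in a..t, (g x - P x - m) with hφ
  have hφL : LipOn φ a b := hψ.lipOn_integral hab.le
  have hφa : φ a = 0 := by simp [hφ]
  have hφb : φ b = 0 := by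
    simp only [hφ]
    rw [intervalIntegral.integral_sub (hk.intervalIntegrable hab.le) (by simp)]
    simp only [intervalIntegral.integral_const, smul_eq_mul, hm]
    field_simp
    ring
  have hdφ := hψ.ae_hasDerivAt_integral hab.le
  have hdP := hh.ae_hasDerivAt_integral hab.le
  have hparts := (hPL.absolutelyContinuousOnInterval hab.le).integral_mul_deriv_eq_deriv_mul
    (hφL.absolutelyContinuousOnInterval hab.le)
  rw [hφa, hφb, intervalIntegral_congr_ae_restrict hab.le (g := fun t => deriv P t * φ t)
    (h := fun t => h t * φ t) (by
      filter_upwards [hdP] with t ht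
      rw [ht.deriv])] at hparts
  have hH := H φ hφL hφa hφb
  have hdφE : EssBdd (deriv φ) a b := .deriv hφL
  have hφE : EssBdd φ a b := .of_continuousOn hφL.continuousOn
  have hPE : EssBdd P a b := .of_continuousOn hPL.continuousOn
  rw [intervalIntegral.integral_add ((hg.mul hdφE).intervalIntegrable hab.le)
    ((hh.mul hφE).intervalIntegrable hab.le)] at hH
  have hmean : ∫ t in a..b, m * deriv φ t = 0 := by
    rw [intervalIntegral.integral_const_mul, hφL.integral_deriv hab.le, hφa, hφb]
    simp
  have hsq : ∫ t in a..b, (g t - P t - m) ^ 2 = 0 := by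
    have e : ∫ t in a..b, (g t - P t - m) ^ 2
        = ∫ t in a..b, (g t * deriv φ t - P t * deriv φ t - m * deriv φ t) := by
      refine intervalIntegral_congr_ae_restrict hab.le ?_
      filter_upwards [hdφ] with t ht
      rw [ht.deriv]
      ring
    rw [e, intervalIntegral.integral_sub, intervalIntegral.integral_sub, hmean]
    · linarith
    · exact (hg.mul hdφE).intervalIntegrable hab.le
    · exact (hPE.mul hdφE).intervalIntegrable hab.le
    · exact ((hg.mul hdφE).sub (hPE.mul hdφE)).intervalIntegrable hab.le
    · exact ((EssBdd.const m a b).mul hdφE).intervalIntegrable hab.le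
  rw [intervalIntegral.integral_of_le hab.le, integral_eq_zero_iff_of_nonneg
    (fun t => sq_nonneg _)
    ((intervalIntegrable_iff_integrableOn_Ioc_of_le hab.le).1
      (hψ.pow_two.intervalIntegrable hab.le))] at hsq
  refine ⟨m, ?_⟩
  filter_upwards [hsq] with t ht
  have := pow_eq_zero_iff (two_ne_zero) |>.1 ht
  linarith

theorem hasDerivWithinAt_integral_of_continuousOn {g : ℝ → ℝ} {a b : ℝ} (hab : a ≤ b)
    (hg : ContinuousOn g (Icc a b)) {t : ℝ} (ht : t ∈ Icc a b) :
    HasDerivWithinAt (fun x => ∫ y in a..x, g y) (g t) (Icc a b) t := by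
  have hG : Continuous (IccExtend hab ((Icc a b).domRestrict g)) :=
    (continuousOn_iff_continuous_domRestrict.1 hg).Icc_extend'
  have hGg : ∀ x ∈ Icc a b, IccExtend hab ((Icc a b).domRestrict g) x = g x := fun x hx => by
    rw [IccExtend_of_mem hab _ hx]; rfl
  have key : ∀ x ∈ Icc a b,
      ∫ y in a..x, g y = ∫ y in a..x, IccExtend hab ((Icc a b).domRestrict g) y := by
    intro x hx
    refine intervalIntegral.integral_congr fun y hy => (hGg y ?_).symm
    rw [uIcc_of_le hx.1] at hy
    exact ⟨hy.1, hy.2.trans hx.2⟩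
  rw [← hGg t ht]
  exact ((hG.integral_hasStrictDerivAt a t).hasDerivAt.hasDerivWithinAt).congr key (key t ht)

/-- A Lipschitz function whose derivative agrees almost everywhere with a continuous function
is continuously differentiable. -/
theorem LipOn.hasDerivWithinAt_of_ae {c g : ℝ → ℝ} {a b : ℝ} (hab : a < b) (hc : LipOn c a b)
    (hg : ContinuousOn g (Icc a b))
    (h : ∀ᵐ t ∂(volume.restrict (Ioc a b)), deriv c t = g t) {t : ℝ} (ht : t ∈ Icc a b) :
    HasDerivWithinAt c (g t) (Icc a b) t := by
  have key : ∀ x ∈ Icc a b, c x = c a + ∫ y in a..x, g y := by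
    intro x hx
    have h1 := (hc.mono le_rfl hx.2).integral_deriv hx.1
    rw [intervalIntegral_congr_ae_restrict hx.1 (h := g) (ae_restrict_of_ae_restrict_of_subset
      (Ioc_subset_Ioc_right hx.2) h)] at h1
    linarith
  exact ((hasDerivWithinAt_integral_of_continuousOn hab.le hg ht).const_add (c a)).congr key
    (key t ht)

/-! ### Minimizers of the energy of a warped product -/

section Warped

variable {n : ℕ} {f : ℝ → ℝ} {s : ℝ → ℝ} {θ : ℝ → E n} {a b : ℝ}

theorem EssBdd.integral_mono {g h : ℝ → ℝ} (hab : a ≤ b) (hg : EssBdd g a b) (hh : EssBdd h a b)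
    (hgh : ∀ᵐ t ∂(volume.restrict (Ioc a b)), g t ≤ h t) :
    ∫ t in a..b, g t ≤ ∫ t in a..b, h t := by
  rw [intervalIntegral.integral_of_le hab, intervalIntegral.integral_of_le hab]
  exact setIntegral_mono_ae_restrict
    ((intervalIntegrable_iff_integrableOn_Ioc_of_le hab).1 (hg.intervalIntegrable hab))
    ((intervalIntegrable_iff_integrableOn_Ioc_of_le hab).1 (hh.intervalIntegrable hab)) hgh

/-- The squared speed at time `t` of the curve `(s, θ)` in the warped product
`ds² + f(s)² |dθ|²` of a line and the unit sphere. -/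
noncomputable def warpedSpeedSq (f s : ℝ → ℝ) (θ : ℝ → E n) (t : ℝ) : ℝ :=
  deriv s t ^ 2 + f (s t) ^ 2 * ‖deriv θ t‖ ^ 2

theorem EssBdd.warpedSpeedSq (hf : Continuous f) (hs : LipOn s a b) (hθ : LipOn θ a b) :
    EssBdd (warpedSpeedSq f s θ) a b :=
  (EssBdd.deriv hs).pow_two.add ((EssBdd.of_continuousOn (g := fun t => f (s t) ^ 2)
    ((hf.comp_continuousOn hs.continuousOn).pow 2)).mul (EssBdd.norm_deriv hθ).pow_two)

/-- If the energies of a family of curves are bounded above by `∫ (A + ε B + ε² C)`, and the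
curve with energy `∫ A` is a minimizer, then the first variation `∫ B` vanishes. -/
theorem integral_eq_zero_of_first_variation {A B C : ℝ → ℝ} (hab : a ≤ b) (hA : EssBdd A a b)
    (hB : EssBdd B a b) (hC : EssBdd C a b)
    (H : ∀ ε : ℝ, |ε| ≤ 1 → ∃ D : ℝ → ℝ, EssBdd D a b ∧
      (∀ᵐ t ∂(volume.restrict (Ioc a b)), D t ≤ A t + (ε * B t + ε ^ 2 * C t)) ∧
      ∫ t in a..b, A t ≤ ∫ t in a..b, D t) :
    ∫ t in a..b, B t = 0 := by
  set J := ∫ t in a..b, B t with hJ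
  set K := ∫ t in a..b, C t with hK
  have key : ∀ ε : ℝ, |ε| ≤ 1 → 0 ≤ ε * J + ε ^ 2 * K := by
    intro ε hε
    obtain ⟨D, hD, hDle, hAD⟩ := H ε hε
    have hεB := (EssBdd.const ε a b).mul hB
    have hεC := (EssBdd.const (ε ^ 2) a b).mul hC
    have h1 := hD.integral_mono hab (hA.add (hεB.add hεC)) hDle
    rw [intervalIntegral.integral_add (hA.intervalIntegrable hab)
      ((hεB.add hεC).intervalIntegrable hab), intervalIntegral.integral_add
      (hεB.intervalIntegrable hab) (hεC.intervalIntegrable hab),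
      intervalIntegral.integral_const_mul, intervalIntegral.integral_const_mul] at h1
    linarith
  by_contra hne
  -- A small `ε` of the sign opposite to `J` makes `ε J + ε² K` negative.
  have hpos : 0 < |J| + |K| := by have := abs_pos.2 hne; positivity
  have hε : |(-J / (2 * (|J| + |K|)))| ≤ 1 := by
    rw [abs_div, abs_neg, abs_of_pos (by positivity : 0 < 2 * (|J| + |K|)),
      div_le_one (by positivity)]
    linarith [abs_nonneg J, abs_nonneg K]
  have h2 := key _ hε
  have h3 : -J / (2 * (|J| + |K|)) * J + (-J / (2 * (|J| + |K|))) ^ 2 * K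
      = J ^ 2 / (4 * (|J| + |K|) ^ 2) * (K - 2 * (|J| + |K|)) := by
    field_simp
    ring
  rw [h3] at h2
  have h4 : 0 < J ^ 2 / (4 * (|J| + |K|) ^ 2) := by positivity
  have h5 : K - 2 * (|J| + |K|) < 0 := by linarith [le_abs_self K, abs_nonneg J]
  nlinarith

/-- A uniform quadratic Taylor bound on a compact interval. -/
theorem exists_le_taylor_quadratic {G : ℝ → ℝ} (hG : ContDiff ℝ 2 G) (l u D : ℝ) :
    ∃ K, ∀ x ∈ Icc l u, ∀ δ, |δ| ≤ D → G (x + δ) ≤ G x + deriv G x * δ + K * δ ^ 2 := by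
  have hG1 : ContDiff ℝ 1 (deriv G) := (contDiff_succ_iff_deriv.1 hG).2.2
  obtain ⟨K, hK⟩ : LipOn (deriv G) (l - D) (u + D) :=
    LipOn.comp_contDiff (c := fun x => x) ⟨1, LipschitzWith.id.lipschitzOnWith⟩ hG1
  refine ⟨K, fun x hx δ hδ => ?_⟩
  have hd : Differentiable ℝ G := hG.differentiable (by norm_num)
  have hder : ∀ τ ∈ uIcc 0 δ, HasDerivWithinAt (fun τ => G (x + τ) - deriv G x * τ)
      (deriv G (x + τ) - deriv G x) (uIcc 0 δ) τ := by
    intro τ _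
    have h1 : HasDerivAt (fun τ => G (x + τ)) (deriv G (x + τ)) τ :=
      HasDerivAt.comp_const_add x τ (hd (x + τ)).hasDerivAt
    simpa using (h1.fun_sub ((hasDerivAt_id τ).const_mul (deriv G x))).hasDerivWithinAt
  have habs : ∀ τ ∈ uIcc 0 δ, |τ| ≤ |δ| := fun τ hτ => by
    simpa using abs_sub_left_of_mem_uIcc hτ
  have hbd : ∀ τ ∈ uIcc 0 δ, ‖deriv G (x + τ) - deriv G x‖ ≤ K * |δ| := by
    intro τ hτ
    have h1 := abs_le.1 ((habs τ hτ).trans hδ)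
    have hD0 : 0 ≤ D := (abs_nonneg δ).trans hδ
    have h2 := hK.dist_le_mul (x + τ) ⟨by linarith [hx.1], by linarith [hx.2]⟩ x
      ⟨by linarith [hx.1], by linarith [hx.2]⟩
    rw [Real.dist_eq, Real.dist_eq, add_sub_cancel_left] at h2
    exact h2.trans (mul_le_mul_of_nonneg_left (habs τ hτ) K.2)
  have := (convex_uIcc 0 δ).norm_image_sub_le_of_norm_hasDerivWithin_le hder hbd
    left_mem_uIcc right_mem_uIcc
  simp only [add_zero, mul_zero, sub_zero, Real.norm_eq_abs] at this
  have h3 := (le_abs_self _).trans this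
  rw [mul_assoc, ← sq, sq_abs] at h3
  linarith

/-- Radial projection to the unit sphere does not increase distances outside the unit ball. -/
theorem norm_normalize_sub_le {x y : E n} (hx : 1 ≤ ‖x‖) (hy : 1 ≤ ‖y‖) :
    ‖‖x‖⁻¹ • x - ‖y‖⁻¹ • y‖ ≤ ‖x - y‖ := by
  have hx0 : ‖x‖ ≠ 0 := by positivity
  have hy0 : ‖y‖ ≠ 0 := by positivity
  have hu : inner ℝ x y / (‖x‖ * ‖y‖) ≤ 1 :=
    div_le_one_of_le₀ (real_inner_le_norm x y) (by positivity)
  have hp : inner ℝ x y = inner ℝ x y / (‖x‖ * ‖y‖) * (‖x‖ * ‖y‖) := by field_simp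
  refine le_of_sq_le_sq ?_ (norm_nonneg _)
  rw [norm_sub_sq_real, norm_sub_sq_real, norm_smul, norm_smul, norm_inv, norm_inv, norm_norm,
    norm_norm, inv_mul_cancel₀ hx0, inv_mul_cancel₀ hy0, inner_smul_left, inner_smul_right]
  have e : (starRingEnd ℝ) ‖x‖⁻¹ * (‖y‖⁻¹ * inner ℝ x y) = inner ℝ x y / (‖x‖ * ‖y‖) := by
    simp; field_simp
  rw [e]
  nth_rewrite 2 [hp]
  have h1 : 0 ≤ (‖x‖ * ‖y‖ - 1) * (1 - inner ℝ x y / (‖x‖ * ‖y‖)) :=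
    mul_nonneg (by nlinarith) (by linarith)
  nlinarith [sq_nonneg (‖x‖ - ‖y‖)]

/-- The curve `(s, θ)` in the warped product `ds² + f(s)² |dθ|²` of a line and the unit sphere
minimizes the energy among Lipschitz curves on `[a, b]` with the same endpoints. -/
structure IsEnergyMinimizer (f s : ℝ → ℝ) (θ : ℝ → E n) (a b : ℝ) : Prop where
  lip_fst : LipOn s a b
  lip_snd : LipOn θ a b
  norm_snd : ∀ t ∈ Icc a b, ‖θ t‖ = 1
  le : ∀ (σ : ℝ → ℝ) (η : ℝ → E n), LipOn σ a b → LipOn η a b → (∀ t ∈ Icc a b, ‖η t‖ = 1) →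
    σ a = s a → σ b = s b → η a = θ a → η b = θ b →
    ∫ t in a..b, warpedSpeedSq f s θ t ≤ ∫ t in a..b, warpedSpeedSq f σ η t

namespace IsEnergyMinimizer

/-- The weak Euler-Lagrange equation for variations of the line component. -/
theorem integral_radial_variation (hf : ContDiff ℝ 2 f) (hab : a ≤ b)
    (h : IsEnergyMinimizer f s θ a b) {φ : ℝ → ℝ} (hφ : LipOn φ a b) (hφa : φ a = 0)
    (hφb : φ b = 0) :
    ∫ t in a..b, (2 * deriv s t * deriv φ t +
      deriv (fun x => f x ^ 2) (s t) * ‖deriv θ t‖ ^ 2 * φ t) = 0 := by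
  have hG : ContDiff ℝ 2 (fun x => f x ^ 2) := hf.pow 2
  have hG1 : Continuous (deriv fun x => f x ^ 2) := hG.continuous_deriv (by norm_num)
  obtain ⟨D, hD⟩ := isCompact_Icc.exists_bound_of_continuousOn hφ.continuousOn
  obtain ⟨M, hM⟩ := isCompact_Icc.exists_bound_of_continuousOn h.lip_fst.continuousOn
  obtain ⟨K, hK⟩ := exists_le_taylor_quadratic hG (-M) M D
  have hsE := EssBdd.deriv h.lip_fst
  have hφE := EssBdd.deriv hφ
  have hφE0 := EssBdd.of_continuousOn hφ.continuousOn
  have hθE := (EssBdd.norm_deriv h.lip_snd).pow_two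
  have hGE : EssBdd (fun t => deriv (fun x => f x ^ 2) (s t)) a b :=
    .of_continuousOn (hG1.comp_continuousOn h.lip_fst.continuousOn)
  refine integral_eq_zero_of_first_variation hab
    (A := warpedSpeedSq f s θ) (C := fun t => deriv φ t ^ 2 + K * φ t ^ 2 * ‖deriv θ t‖ ^ 2)
    (.warpedSpeedSq hf.continuous h.lip_fst h.lip_snd)
    ((((EssBdd.const 2 a b).mul hsE).mul hφE).add ((hGE.mul hθE).mul hφE0))
    (hφE.pow_two.add (((EssBdd.const K a b).mul hφE0.pow_two).mul hθE)) fun ε hε => ?_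
  have hσ : LipOn (fun t => s t + ε * φ t) a b :=
    h.lip_fst.add ((LipOn.const ε a b).smul hφ)
  refine ⟨warpedSpeedSq f (fun t => s t + ε * φ t) θ, .warpedSpeedSq hf.continuous hσ h.lip_snd,
    ?_, h.le _ _ hσ h.lip_snd h.norm_snd (by simp [hφa]) (by simp [hφb]) rfl rfl⟩
  filter_upwards [h.lip_fst.ae_hasDerivAt, hφ.ae_hasDerivAt, ae_mem_Ioo a b] with t h1 h2 ht
  have ht' := Ioo_subset_Icc_self ht
  have h3 : deriv (fun t => s t + ε * φ t) t = deriv s t + ε * deriv φ t :=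
    (h1.add (h2.const_mul ε)).deriv
  have h4 := hK (s t) (abs_le.1 (hM t ht')) (ε * φ t) (by
    rw [abs_mul]
    calc |ε| * |φ t| ≤ 1 * D := mul_le_mul hε (hD t ht') (abs_nonneg _) zero_le_one
      _ = D := one_mul D)
  have h5 := mul_le_mul_of_nonneg_right h4 (sq_nonneg ‖deriv θ t‖)
  simp only [warpedSpeedSq, h3]
  linarith

theorem ae_inner_deriv_eq_zero (h : IsEnergyMinimizer f s θ a b) :
    ∀ᵐ t ∂(volume.restrict (Ioc a b)), inner ℝ (θ t) (deriv θ t) = 0 := by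
  filter_upwards [h.lip_snd.ae_hasDerivAt, ae_mem_Ioo a b] with t h1 ht
  exact inner_deriv_eq_zero_of_norm_eq_one h1
    (eventually_of_mem (Icc_mem_nhds ht.1 ht.2) h.norm_snd)

/-- The weak Euler-Lagrange equation for variations of the sphere component by the infinitesimal
rotation `A`. The varied curve is `θ + ε φ A θ`, projected back to the sphere; since it runs outside
the ball, the projection does not increase its speed. -/
theorem integral_rotation_variation (hf : Continuous f) (hab : a ≤ b)
    (h : IsEnergyMinimizer f s θ a b) (A : E n →L[ℝ] E n) (hA : ∀ v, inner ℝ v (A v) = 0)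
    {φ : ℝ → ℝ} (hφ : LipOn φ a b) (hφa : φ a = 0) (hφb : φ b = 0) :
    ∫ t in a..b, 2 * (f (s t) ^ 2 * inner ℝ (A (θ t)) (deriv θ t) * deriv φ t) = 0 := by
  have hψ : LipOn (fun t => φ t • A (θ t)) a b :=
    hφ.smul (h.lip_snd.comp_contDiff A.contDiff)
  have hfE : EssBdd (fun t => f (s t) ^ 2) a b :=
    .of_continuousOn ((hf.comp_continuousOn h.lip_fst.continuousOn).pow 2)
  have hIE : EssBdd (fun t => inner ℝ (A (θ t)) (deriv θ t)) a b :=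
    .inner_deriv h.lip_snd (A.continuous.comp_continuousOn h.lip_snd.continuousOn)
  refine integral_eq_zero_of_first_variation hab
    (A := warpedSpeedSq f s θ) (C := fun t => f (s t) ^ 2 * ‖deriv (fun t => φ t • A (θ t)) t‖ ^ 2)
    (.warpedSpeedSq hf h.lip_fst h.lip_snd)
    ((EssBdd.const 2 a b).mul ((hfE.mul hIE).mul (EssBdd.deriv hφ)))
    (hfE.mul (EssBdd.norm_deriv hψ).pow_two) fun ε hε => ?_
  set ζ : ℝ → E n := fun t => θ t + ε • (φ t • A (θ t)) with hζdef
  have hζ : LipOn ζ a b := h.lip_snd.add ((LipOn.const ε a b).smul hψ)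
  have hζ1 : ∀ t ∈ Icc a b, 1 ≤ ‖ζ t‖ := by
    intro t ht
    have h1 : ‖ζ t‖ ^ 2 = 1 + ‖ε • (φ t • A (θ t))‖ ^ 2 := by
      rw [hζdef]
      simp only [norm_add_sq_real, h.norm_snd t ht, inner_smul_right, hA]
      ring
    nlinarith [norm_nonneg (ζ t), sq_nonneg ‖ε • (φ t • A (θ t))‖]
  have hη : LipOn (fun t => ‖ζ t‖⁻¹ • ζ t) a b := by
    refine hζ.comp_contDiffAt (g := fun x => ‖x‖⁻¹ • x) fun t ht => ?_
    have h0 : ζ t ≠ 0 := norm_pos_iff.1 (zero_lt_one.trans_le (hζ1 t ht))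
    exact ((contDiffAt_norm ℝ h0).inv (norm_ne_zero_iff.2 h0)).smul contDiffAt_id
  refine ⟨warpedSpeedSq f s (fun t => ‖ζ t‖⁻¹ • ζ t), .warpedSpeedSq hf h.lip_fst hη, ?_,
    h.le _ _ h.lip_fst hη (fun t ht => ?_) rfl rfl ?_ ?_⟩
  · filter_upwards [h.lip_snd.ae_hasDerivAt, hφ.ae_hasDerivAt, hψ.ae_hasDerivAt,
      hη.ae_hasDerivAt, ae_mem_Ioo a b, h.ae_inner_deriv_eq_zero] with t h1 h2 h3 h4 ht h6
    have hζ' : HasDerivAt ζ (deriv θ t + ε • deriv (fun t => φ t • A (θ t)) t) t :=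
      h1.add (h3.const_smul ε)
    have h7 : ‖deriv (fun t => ‖ζ t‖⁻¹ • ζ t) t‖
        ≤ ‖deriv θ t + ε • deriv (fun t => φ t • A (θ t)) t‖ := by
      refine norm_deriv_le_of_dist_le h4 hζ' ?_
      filter_upwards [Icc_mem_nhds ht.1 ht.2] with x hx
      exact norm_normalize_sub_le (hζ1 x hx) (hζ1 t (Ioo_subset_Icc_self ht))
    have h8 : deriv (fun t => φ t • A (θ t)) t = φ t • A (deriv θ t) + deriv φ t • A (θ t) :=
      (h2.smul (A.hasFDerivAt.comp_hasDerivAt t h1)).deriv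
    have h9 : ‖deriv θ t + ε • deriv (fun t => φ t • A (θ t)) t‖ ^ 2 = ‖deriv θ t‖ ^ 2
        + (ε * (2 * (inner ℝ (A (θ t)) (deriv θ t) * deriv φ t))
        + ε ^ 2 * ‖deriv (fun t => φ t • A (θ t)) t‖ ^ 2) := by
      rw [norm_add_sq_real, norm_smul, mul_pow, Real.norm_eq_abs, sq_abs, inner_smul_right]
      nth_rewrite 1 [h8]
      rw [inner_add_right, inner_smul_right, inner_smul_right, hA, real_inner_comm (A (θ t))]
      ring
    have h10 := mul_le_mul_of_nonneg_left (pow_le_pow_left₀ (norm_nonneg _) h7 2)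
      (sq_nonneg (f (s t)))
    rw [h9] at h10
    simp only [warpedSpeedSq]
    linarith
  · have h0 : ‖ζ t‖ ≠ 0 := (zero_lt_one.trans_le (hζ1 t ht)).ne'
    rw [norm_smul, norm_inv, norm_norm, inv_mul_cancel₀ h0]
  · simp [hζdef, hφa, h.norm_snd a (left_mem_Icc.2 hab)]
  · simp [hζdef, hφb, h.norm_snd b (right_mem_Icc.2 hab)]

/-- Conservation of the angular momentum of a minimizer. -/
theorem exists_angular_momentum (hf : Continuous f) (hab : a < b)
    (h : IsEnergyMinimizer f s θ a b) (i j : Fin n) :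
    ∃ C, ∀ᵐ t ∂(volume.restrict (Ioc a b)),
      f (s t) ^ 2 * (θ t i * deriv θ t j - θ t j * deriv θ t i) = C := by
  set A : E n →L[ℝ] E n :=
    (EuclideanSpace.proj i : E n →L[ℝ] ℝ).smulRight (EuclideanSpace.single j (1 : ℝ)) -
    (EuclideanSpace.proj j : E n →L[ℝ] ℝ).smulRight (EuclideanSpace.single i (1 : ℝ)) with hAdef
  have hA : ∀ v w, inner ℝ (A v) w = v i * w j - v j * w i := by
    intro v w
    simp [hAdef, inner_sub_left, inner_smul_left, EuclideanSpace.inner_single_left]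
  have hA0 : ∀ v, inner ℝ v (A v) = 0 := fun v => by
    rw [real_inner_comm, hA]; ring
  have hE : EssBdd (fun t => 2 * (f (s t) ^ 2 * inner ℝ (A (θ t)) (deriv θ t))) a b :=
    (EssBdd.const 2 a b).mul ((EssBdd.of_continuousOn (g := fun t => f (s t) ^ 2)
      ((hf.comp_continuousOn h.lip_fst.continuousOn).pow 2)).mul
      (.inner_deriv h.lip_snd (A.continuous.comp_continuousOn h.lip_snd.continuousOn)))
  obtain ⟨C, hC⟩ := exists_eq_const_add_integral hab hE (.const 0 a b) fun φ hφ hφa hφb => by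
    refine Eq.trans ?_ (h.integral_rotation_variation hf hab.le A hA0 hφ hφa hφb)
    refine intervalIntegral.integral_congr fun t _ => ?_
    simp only [zero_mul, add_zero]
    ring
  refine ⟨C / 2, ?_⟩
  filter_upwards [hC] with t ht
  rw [hA] at ht
  simp only [intervalIntegral.integral_zero] at ht
  linarith

/-- Energy minimizers are smooth, and satisfy the geodesic equation `s'' = f f'(s) |θ'|²`. -/
theorem exists_hasDerivWithinAt (hf : ContDiff ℝ 2 f) (hpos : ∀ x, 0 < f x) (hab : a < b)
    (h : IsEnergyMinimizer f s θ a b) :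
    ∃ (q : ℝ → ℝ) (m : ℝ → E n), ContinuousOn m (Icc a b) ∧
      (∀ t ∈ Icc a b, HasDerivWithinAt θ (m t) (Icc a b) t) ∧
      (∀ t ∈ Icc a b, HasDerivWithinAt s (q t) (Icc a b) t) ∧
      ∀ t ∈ Icc a b, HasDerivWithinAt q (f (s t) * deriv f (s t) * ‖m t‖ ^ 2) (Icc a b) t := by
  choose C hC using h.exists_angular_momentum hf.continuous hab
  set m : ℝ → E n := fun t =>
    WithLp.toLp 2 fun j => (f (s t) ^ 2)⁻¹ * ∑ i, θ t i * C i j with hm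
  have hθc : ∀ i, ContinuousOn (fun t => θ t i) (Icc a b) := fun i =>
    (EuclideanSpace.proj i : E n →L[ℝ] ℝ).continuous.comp_continuousOn h.lip_snd.continuousOn
  have hfc : ContinuousOn (fun t => f (s t)) (Icc a b) :=
    hf.continuous.comp_continuousOn h.lip_fst.continuousOn
  have hmc : ∀ j, ContinuousOn (fun t => m t j) (Icc a b) := fun j =>
    ((hfc.pow 2).inv₀ fun t _ => (pow_pos (hpos _) 2).ne').mul
      (continuousOn_finsetSum _ fun i _ => (hθc i).mul continuousOn_const)
  have hmcont : ContinuousOn m (Icc a b) :=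
    (PiLp.continuous_toLp 2 _).comp_continuousOn (continuousOn_pi.2 hmc)
  -- As `θ` is a unit vector orthogonal to `θ'`, the angular momenta determine `θ'`.
  have hderiv : ∀ᵐ t ∂(volume.restrict (Ioc a b)), deriv θ t = m t := by
    filter_upwards [ae_all_iff.2 fun i => ae_all_iff.2 (hC i), h.ae_inner_deriv_eq_zero,
      ae_mem_Ioo a b] with t h1 h2 ht
    have h3 : ∑ i, θ t i * θ t i = 1 := by
      have := EuclideanSpace.real_norm_sq_eq (θ t)
      rw [h.norm_snd t (Ioo_subset_Icc_self ht)] at this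
      simp only [← sq]
      linarith
    have h4 : ∑ i, θ t i * deriv θ t i = 0 := by
      rw [← h2, PiLp.inner_apply]
      exact Finset.sum_congr rfl fun i _ => by simp [mul_comm]
    ext j
    have hf0 : f (s t) ^ 2 ≠ 0 := (pow_pos (hpos _) 2).ne'
    simp only [hm, ← h1]
    have h5 : ∑ i, θ t i * (f (s t) ^ 2 * (θ t i * deriv θ t j - θ t j * deriv θ t i))
        = f (s t) ^ 2 * (deriv θ t j * ∑ i, θ t i * θ t i - θ t j * ∑ i, θ t i * deriv θ t i) := by
      rw [Finset.mul_sum, Finset.mul_sum, ← Finset.sum_sub_distrib, Finset.mul_sum]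
      exact Finset.sum_congr rfl fun i _ => by ring
    rw [h5, h3, h4, inv_mul_cancel_left₀ hf0]
    ring
  have hθ' : ∀ t ∈ Icc a b, HasDerivWithinAt θ (m t) (Icc a b) t := by
    intro t ht
    rw [hasDerivWithinAt_iff_hasFDerivWithinAt, hasFDerivWithinAt_euclidean]
    intro j
    have hL : LipOn (fun t => θ t j) a b :=
      h.lip_snd.comp_contDiff (EuclideanSpace.proj j : E n →L[ℝ] ℝ).contDiff
    have := hL.hasDerivWithinAt_of_ae hab (hmc j) (by
      filter_upwards [hderiv, h.lip_snd.ae_hasDerivAt] with x h1 h2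
      rw [← h1]
      exact ((EuclideanSpace.proj j : E n →L[ℝ] ℝ).hasFDerivAt.comp_hasDerivAt x h2).deriv) ht
    convert! this.hasFDerivWithinAt using 1
  have hG : ContDiff ℝ 2 (fun x => f x ^ 2) := hf.pow 2
  have hG1 : Continuous (deriv fun x => f x ^ 2) := hG.continuous_deriv (by norm_num)
  have hGE : EssBdd (fun t => deriv (fun x => f x ^ 2) (s t) * ‖deriv θ t‖ ^ 2) a b :=
    (EssBdd.of_continuousOn (hG1.comp_continuousOn h.lip_fst.continuousOn)).mul
      (EssBdd.norm_deriv h.lip_snd).pow_two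
  obtain ⟨Q, hQ⟩ := exists_eq_const_add_integral hab
    ((EssBdd.const 2 a b).mul (EssBdd.deriv h.lip_fst)) hGE fun φ hφ hφa hφb =>
      h.integral_radial_variation hf hab.le hφ hφa hφb
  have hdf : ∀ x, deriv (fun x => f x ^ 2) x = 2 * (f x * deriv f x) := fun x => by
    have := ((hf.differentiable (by norm_num) x).hasDerivAt.fun_pow 2).deriv
    simpa [mul_assoc] using this
  set g : ℝ → ℝ := fun t => f (s t) * deriv f (s t) * ‖m t‖ ^ 2 with hg
  have hgc : ContinuousOn g (Icc a b) :=
    (hfc.mul ((hf.continuous_deriv (by norm_num)).comp_continuousOn h.lip_fst.continuousOn)).mul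
      (hmcont.norm.pow 2)
  set q : ℝ → ℝ := fun t => Q / 2 + ∫ x in a..t, g x with hq
  have hqd : ∀ t ∈ Icc a b, HasDerivWithinAt q (g t) (Icc a b) t := fun t ht =>
    (hasDerivWithinAt_integral_of_continuousOn hab.le hgc ht).const_add _
  refine ⟨q, m, hmcont, hθ', fun t ht => ?_, hqd⟩
  refine h.lip_fst.hasDerivWithinAt_of_ae hab (fun t ht => (hqd t ht).continuousWithinAt) ?_ ht
  filter_upwards [hQ, ae_mem_Ioo a b] with t h1 ht'
  have h2 : ∫ x in a..t, deriv (fun x => f x ^ 2) (s x) * ‖deriv θ x‖ ^ 2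
      = ∫ x in a..t, 2 * g x := by
    refine intervalIntegral_congr_ae_restrict ht'.1.le ?_
    filter_upwards [ae_restrict_of_ae_restrict_of_subset (Ioc_subset_Ioc_right ht'.2.le) hderiv]
      with x hx
    rw [hx, hdf, hg]
    ring
  rw [h2, intervalIntegral.integral_const_mul] at h1
  simp only [hq]
  linarith

end IsEnergyMinimizer

end Warped

/-! ### The hyperbolic distance to the centre of the ball -/

section Centre

variable {n : ℕ}

/-- The Euclidean norm `tanh (r / 2)` of the points at hyperbolic distance `r` from the centre of
the ball. -/
noncomputable def tanhHalf (r : ℝ) : ℝ := (Real.exp r - 1) / (Real.exp r + 1)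

/-- The hyperbolic distance to the centre of the ball of the points of Euclidean norm `ρ`. -/
noncomputable def hypRadius (ρ : ℝ) : ℝ := Real.log ((1 + ρ) / (1 - ρ))

theorem one_sub_tanhHalf_sq (r : ℝ) :
    1 - tanhHalf r ^ 2 = 4 * Real.exp r / (Real.exp r + 1) ^ 2 := by
  have := Real.exp_pos r
  unfold tanhHalf
  field_simp
  ring

theorem one_sub_tanhHalf_sq_pos (r : ℝ) : 0 < 1 - tanhHalf r ^ 2 := by
  have := Real.exp_pos r
  rw [one_sub_tanhHalf_sq]
  positivity

theorem tanhHalf_zero : tanhHalf 0 = 0 := by simp [tanhHalf]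

theorem tanhHalf_pos {r : ℝ} (hr : 0 < r) : 0 < tanhHalf r :=
  div_pos (sub_pos.2 (Real.one_lt_exp_iff.2 hr)) (by positivity)

theorem abs_tanhHalf_lt_one (r : ℝ) : |tanhHalf r| < 1 := by
  rw [← sq_lt_one_iff_abs_lt_one]
  linarith [one_sub_tanhHalf_sq_pos r]

theorem hasDerivAt_tanhHalf (r : ℝ) : HasDerivAt tanhHalf ((1 - tanhHalf r ^ 2) / 2) r := by
  have h0 : Real.exp r + 1 ≠ 0 := by positivity
  have := ((Real.hasDerivAt_exp r).sub_const 1).div ((Real.hasDerivAt_exp r).add_const 1) h0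
  convert! this using 1
  rw [one_sub_tanhHalf_sq]
  field_simp
  ring

theorem contDiff_tanhHalf : ContDiff ℝ 2 tanhHalf :=
  (Real.contDiff_exp.sub contDiff_const).div (Real.contDiff_exp.add contDiff_const)
    fun r => by positivity

theorem hypRadius_zero : hypRadius 0 = 0 := by simp [hypRadius]

theorem hypRadius_tanhHalf (r : ℝ) : hypRadius (tanhHalf r) = r := by
  have := Real.exp_pos r
  have h : (1 + tanhHalf r) / (1 - tanhHalf r) = Real.exp r := by
    have h1 : 1 - tanhHalf r = 2 / (Real.exp r + 1) := by
      unfold tanhHalf; field_simp; ring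
    have h2 : 1 + tanhHalf r = 2 * Real.exp r / (Real.exp r + 1) := by
      unfold tanhHalf; field_simp; ring
    rw [h1, h2]
    field_simp
  rw [hypRadius, h, Real.log_exp]

theorem tanhHalf_hypRadius {ρ : ℝ} (h0 : 0 ≤ ρ) (h1 : ρ < 1) : tanhHalf (hypRadius ρ) = ρ := by
  have h2 : 0 < 1 - ρ := by linarith
  rw [tanhHalf, hypRadius, Real.exp_log (by positivity)]
  field_simp
  ring

theorem hypRadius_pos {ρ : ℝ} (h0 : 0 < ρ) (h1 : ρ < 1) : 0 < hypRadius ρ :=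
  Real.log_pos (by rw [lt_div_iff₀] <;> linarith)

theorem contDiffAt_hypRadius {ρ : ℝ} (h0 : 0 ≤ ρ) (h1 : ρ < 1) : ContDiffAt ℝ 1 hypRadius ρ := by
  have h2 : 0 < 1 - ρ := by linarith
  refine ContDiffAt.log (ContDiffAt.div (by fun_prop) (by fun_prop) h2.ne') ?_
  positivity

theorem hasDerivAt_hypRadius {ρ : ℝ} (h0 : 0 ≤ ρ) (h1 : ρ < 1) :
    HasDerivAt hypRadius (2 / (1 - ρ ^ 2)) ρ := by
  have h2 : 1 - ρ ≠ 0 := by linarith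
  have h4 : 1 + ρ ≠ 0 := by linarith
  have h3 : (1 + ρ) / (1 - ρ) ≠ 0 := div_ne_zero h4 h2
  have h5 : 1 - ρ ^ 2 ≠ 0 := by
    rw [show 1 - ρ ^ 2 = (1 - ρ) * (1 + ρ) by ring]; exact mul_ne_zero h2 h4
  have := ((((hasDerivAt_id ρ).const_add 1).fun_div ((hasDerivAt_id ρ).const_sub 1) h2).log h3)
  convert! this using 1
  simp only [id]
  field_simp
  rw [show (1 - ρ ^ 2) = (1 - ρ) * (1 + ρ) by ring]
  field_simp
  ring

theorem mem_hypSpace {x : E n} : x ∈ hypSpace n ↔ ‖x‖ < 1 := by simp [hypSpace]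

theorem hypFactor_pos {x : E n} (hx : x ∈ hypSpace n) : 0 < hypFactor x := by
  have := mem_hypSpace.1 hx
  exact div_pos two_pos (by nlinarith [norm_nonneg x])

theorem continuousOn_hypFactor : ContinuousOn (hypFactor (n := n)) (hypSpace n) := by
  refine continuousOn_const.div (by fun_prop) fun x hx => ?_
  have := mem_hypSpace.1 hx
  nlinarith [norm_nonneg x]

theorem essBdd_speed {w : E n → ℝ} {M : Set (E n)} (hw : ContinuousOn w M) {c : ℝ → E n} {a b : ℝ}
    (hc : IsLipschitzCurve M c a b) : EssBdd (fun t => w (c t) * ‖deriv c t‖) a b :=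
  (EssBdd.of_continuousOn (g := fun t => w (c t)) (hw.comp (LipOn.continuousOn hc.1) hc.2)).mul
    (EssBdd.norm_deriv hc.1)

/-- A curve is at least as long as the change of the distance to the centre along it. -/
theorem hypRadius_sub_le_length {c : ℝ → E n} {a b : ℝ} (hab : a ≤ b)
    (hc : IsLipschitzCurve (hypSpace n) c a b) :
    hypRadius ‖c a‖ - hypRadius ‖c b‖ ≤ length hypFactor c a b := by
  have hcL : LipOn c a b := hc.1
  have hnorm : LipOn (fun t => ‖c t‖) a b :=
    let ⟨K, hK⟩ := hcL
    ⟨1 * K, lipschitzWith_one_norm.comp_lipschitzOnWith hK⟩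
  have hR : LipOn (fun t => hypRadius ‖c t‖) a b :=
    hnorm.comp_contDiffAt fun t ht =>
      contDiffAt_hypRadius (norm_nonneg _) (mem_hypSpace.1 (hc.2 ht))
  have h1 := hR.integral_deriv hab
  have h2 := (EssBdd.deriv hR).neg.integral_mono hab (essBdd_speed continuousOn_hypFactor hc) (by
    filter_upwards [hcL.ae_hasDerivAt, hnorm.ae_hasDerivAt, ae_mem_Ioo a b] with t h1 h2 ht
    have hb := mem_hypSpace.1 (hc.2 (Ioo_subset_Icc_self ht))
    have h3 := norm_deriv_le_of_dist_le h2 h1 (.of_forall fun x => abs_norm_sub_norm_le _ _)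
    have h4 : HasDerivAt (fun t => hypRadius ‖c t‖) _ t :=
      HasDerivAt.comp (h₂ := hypRadius) t (hasDerivAt_hypRadius (norm_nonneg (c t)) hb) h2
    rw [h4.deriv, ← mul_neg]
    exact mul_le_mul_of_nonneg_left ((neg_le_abs _).trans h3)
      (hypFactor_pos (mem_hypSpace.2 hb)).le)
  rw [intervalIntegral.integral_neg, h1] at h2
  rw [length]
  linarith

theorem smul_tanhHalf_mem_hypSpace {θ : E n} (hθ : ‖θ‖ = 1) (r : ℝ) :
    tanhHalf r • θ ∈ hypSpace n := by
  rw [mem_hypSpace, norm_smul, hθ, mul_one]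
  exact abs_tanhHalf_lt_one r

theorem hypFactor_smul_tanhHalf {θ : E n} (hθ : ‖θ‖ = 1) (r : ℝ) :
    hypFactor (tanhHalf r • θ) = 2 / (1 - tanhHalf r ^ 2) := by
  rw [hypFactor, norm_smul, hθ, mul_one, Real.norm_eq_abs, sq_abs]

theorem hasDerivAt_ray (θ : E n) (l k t : ℝ) : HasDerivAt (fun t => tanhHalf (l - k * t) • θ)
    ((-k * ((1 - tanhHalf (l - k * t) ^ 2) / 2)) • θ) t := by
  have h1 : HasDerivAt (fun t => l - k * t) (-k) t := by
    simpa using ((hasDerivAt_id t).const_mul k).const_sub l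
  simpa [mul_comm] using ((hasDerivAt_tanhHalf (l - k * t)).comp t h1).smul_const θ

theorem isLipschitzCurve_ray {θ : E n} (hθ : ‖θ‖ = 1) (l k a b : ℝ) :
    IsLipschitzCurve (hypSpace n) (fun t => tanhHalf (l - k * t) • θ) a b := by
  refine ⟨LipOn.comp_contDiff (c := fun t => t) (g := fun t => tanhHalf (l - k * t) • θ)
    ⟨1, LipschitzWith.id.lipschitzOnWith⟩ ?_, fun t _ => smul_tanhHalf_mem_hypSpace hθ _⟩
  exact ((contDiff_tanhHalf.of_le (by norm_num)).comp (by fun_prop)).smul contDiff_const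

theorem length_ray {θ : E n} (hθ : ‖θ‖ = 1) (l : ℝ) {k : ℝ} (hk : 0 ≤ k) (a b : ℝ) :
    length hypFactor (fun t => tanhHalf (l - k * t) • θ) a b = k * (b - a) := by
  have : ∀ t, hypFactor (tanhHalf (l - k * t) • θ) *
      ‖deriv (fun t => tanhHalf (l - k * t) • θ) t‖ = k := by
    intro t
    have h0 := one_sub_tanhHalf_sq_pos (l - k * t)
    rw [(hasDerivAt_ray θ l k t).deriv, hypFactor_smul_tanhHalf hθ, norm_smul, hθ, mul_one,
      norm_mul, norm_neg, Real.norm_of_nonneg hk, Real.norm_of_nonneg (by positivity)]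
    field_simp
  rw [length]
  simp only [this, intervalIntegral.integral_const, smul_eq_mul]
  ring

/-- The radial segments are minimizing hyperbolic geodesics. -/
theorem isMinimizingGeodesic_ray {θ : E n} (hθ : ‖θ‖ = 1) {l : ℝ} (hl : 0 < l) :
    IsMinimizingGeodesic hypFactor (hypSpace n) (fun t => tanhHalf (l - 1 * t) • θ) 0 l where
  lt := hl
  curve := isLipschitzCurve_ray hθ _ _ _ _
  arcLength s t _ _ _ := by rw [length_ray hθ l zero_le_one, one_mul]
  minimizing c hc h0 hcl := by
    have := hypRadius_sub_le_length hl.le hc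
    rw [h0, hcl] at this
    rw [length_ray hθ l zero_le_one]
    simp only [norm_smul, hθ, mul_zero, mul_one, one_mul, sub_zero, sub_self, tanhHalf_zero,
      norm_zero, hypRadius_zero, Real.norm_of_nonneg (tanhHalf_pos hl).le,
      hypRadius_tanhHalf] at this
    linarith

theorem hypDist_zero {x : E n} (hx : x ∈ hypSpace n) (hx0 : x ≠ 0) :
    hypDist x 0 = hypRadius ‖x‖ := by
  have hx1 := mem_hypSpace.1 hx
  have hn : ‖x‖ ≠ 0 := norm_ne_zero_iff.2 hx0
  have hpos : 0 < ‖x‖ := norm_pos_iff.2 hx0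
  have hθ : ‖‖x‖⁻¹ • x‖ = 1 := by rw [norm_smul, norm_inv, norm_norm, inv_mul_cancel₀ hn]
  refine IsLeast.csInf_eq ⟨?_, ?_⟩
  · refine ⟨fun t => tanhHalf (hypRadius ‖x‖ - hypRadius ‖x‖ * t) • (‖x‖⁻¹ • x),
      isLipschitzCurve_ray hθ _ _ _ _, ?_, ?_, ?_⟩
    · simp only [mul_zero, sub_zero, tanhHalf_hypRadius hpos.le hx1, smul_smul, mul_inv_cancel₀ hn,
        one_smul]
    · simp [tanhHalf_zero]
    · rw [length_ray hθ _ (hypRadius_pos hpos hx1).le]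
      ring
  · rintro L ⟨c, hc, h0, h1, rfl⟩
    have := hypRadius_sub_le_length zero_le_one hc
    rw [h0, h1, norm_zero, hypRadius_zero] at this
    linarith

theorem distTo_singleton (p x : E n) : distTo {p} x = hypDist x p := by
  simp [distTo]

theorem condFactor_zero {x : E n} (hx : x ∈ hypSpace n \ {0}) :
    condFactor {0} x = (hypRadius ‖x‖)⁻¹ * hypFactor x := by
  rw [condFactor, distTo_singleton, hypDist_zero hx.1 hx.2]

theorem logInvDist_zero {γ : ℝ → E n} {t : ℝ} (hx : γ t ∈ hypSpace n \ {0}) :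
    logInvDist {0} γ t = -Real.log (hypRadius ‖γ t‖) := by
  rw [logInvDist, distTo_singleton, hypDist_zero hx.1 hx.2, one_div, Real.log_inv]

theorem norm_pos_and_lt_one {x : E n} (hx : x ∈ hypSpace n \ {0}) : 0 < ‖x‖ ∧ ‖x‖ < 1 :=
  ⟨norm_pos_iff.2 hx.2, mem_hypSpace.1 hx.1⟩

theorem continuousOn_condFactor_zero :
    ContinuousOn (condFactor (n := n) {0}) (hypSpace n \ {0}) := by
  refine ContinuousOn.congr (f := fun x => (hypRadius ‖x‖)⁻¹ * hypFactor x) ?_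
    fun x hx => condFactor_zero hx
  refine ContinuousOn.mul (ContinuousOn.inv₀ (fun x hx => ?_) fun x hx => ?_)
    (continuousOn_hypFactor.mono sdiff_subset)
  · obtain ⟨h0, h1⟩ := norm_pos_and_lt_one hx
    exact (ContinuousAt.comp (g := hypRadius) (contDiffAt_hypRadius h0.le h1).continuousAt
      continuous_norm.continuousAt).continuousWithinAt
  · obtain ⟨h0, h1⟩ := norm_pos_and_lt_one hx
    exact (hypRadius_pos h0 h1).ne'

end Centre

/-! ### The condition metric as a warped product -/

section Polar

variable {n : ℕ}

/-- The warping function of the condition metric of `{0}`: with `s = -log r`, where `r` is the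
hyperbolic distance to `0`, the metric is
`r⁻² (dr² + sinh² r |dθ|²) = ds² + (sinh r / r)² |dθ|²`. -/
noncomputable def warp (s : ℝ) : ℝ := Real.sinh (Real.exp (-s)) * Real.exp s

theorem contDiff_warp : ContDiff ℝ 2 warp := by
  unfold warp
  exact (Real.contDiff_sinh.comp (Real.contDiff_exp.comp contDiff_neg)).mul Real.contDiff_exp

theorem one_lt_warp (s : ℝ) : 1 < warp s := by
  have h := Real.self_lt_sinh_iff.2 (Real.exp_pos (-s))
  calc (1 : ℝ) = Real.exp (-s) * Real.exp s := by rw [← Real.exp_add]; simp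
    _ < warp s := mul_lt_mul_of_pos_right h (Real.exp_pos s)

theorem sinh_lt_mul_cosh {r : ℝ} (hr : 0 < r) : Real.sinh r < r * Real.cosh r := by
  have hd : ∀ x, HasDerivAt (fun x => x * Real.cosh x - Real.sinh x) (x * Real.sinh x) x := by
    intro x
    have := ((hasDerivAt_id x).fun_mul (Real.hasDerivAt_cosh x)).fun_sub (Real.hasDerivAt_sinh x)
    simpa using this
  have hmono : StrictMonoOn (fun x => x * Real.cosh x - Real.sinh x) (Ici 0) := by
    refine strictMonoOn_of_deriv_pos (convex_Ici 0)
      (fun x _ => (hd x).continuousAt.continuousWithinAt) fun x hx => ?_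
    rw [interior_Ici] at hx
    rw [(hd x).deriv]
    exact mul_pos hx (Real.sinh_pos_iff.2 hx)
  have := hmono self_mem_Ici (mem_Ici.2 hr.le) hr
  simp at this
  linarith

theorem deriv_warp_neg (s : ℝ) : deriv warp s < 0 := by
  have h1 : HasDerivAt (fun s => Real.exp (-s)) (-Real.exp (-s)) s := by
    simpa using (hasDerivAt_neg s).exp
  have h2 := h1.sinh.fun_mul (Real.hasDerivAt_exp s)
  have h3 : deriv warp s = _ := h2.deriv
  have h4 := sinh_lt_mul_cosh (Real.exp_pos (-s))
  rw [h3]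
  have := mul_lt_mul_of_pos_right h4 (Real.exp_pos s)
  linarith

/-- The curve of the ball with polar coordinates `(s, θ)`, where `exp (-s)` is the hyperbolic
distance to the centre. -/
noncomputable def polarCurve (s : ℝ → ℝ) (θ : ℝ → E n) (t : ℝ) : E n :=
  tanhHalf (Real.exp (-s t)) • θ t

variable {s : ℝ → ℝ} {θ : ℝ → E n} {a b t : ℝ}

theorem norm_polarCurve (hθ : ‖θ t‖ = 1) : ‖polarCurve s θ t‖ = tanhHalf (Real.exp (-s t)) := by
  rw [polarCurve, norm_smul, hθ, mul_one, Real.norm_of_nonneg (tanhHalf_pos (Real.exp_pos _)).le]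

theorem polarCurve_mem (hθ : ‖θ t‖ = 1) : polarCurve s θ t ∈ hypSpace n \ {0} := by
  refine ⟨smul_tanhHalf_mem_hypSpace hθ _, fun h => ?_⟩
  have h1 := norm_polarCurve (s := s) hθ
  rw [h, norm_zero] at h1
  exact (tanhHalf_pos (Real.exp_pos (-s t))).ne h1

theorem isLipschitzCurve_polarCurve (hs : LipOn s a b) (hθ : LipOn θ a b)
    (hunit : ∀ t ∈ Icc a b, ‖θ t‖ = 1) :
    IsLipschitzCurve (hypSpace n \ {0}) (polarCurve s θ) a b := by
  refine ⟨(hs.comp_contDiff (g := fun x => tanhHalf (Real.exp (-x))) ?_).smul hθ,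
    fun t ht => polarCurve_mem (hunit t ht)⟩
  exact (contDiff_tanhHalf.of_le (by norm_num)).comp (Real.contDiff_exp.comp contDiff_neg)

theorem hasDerivWithinAt_polarCurve {s' : ℝ} {θ' : E n} {S : Set ℝ}
    (hs : HasDerivWithinAt s s' S t) (hθ : HasDerivWithinAt θ θ' S t) :
    HasDerivWithinAt (polarCurve s θ)
      (tanhHalf (Real.exp (-s t)) • θ' +
        ((1 - tanhHalf (Real.exp (-s t)) ^ 2) / 2 * (Real.exp (-s t) * -s')) • θ t) S t :=
  ((hasDerivAt_tanhHalf _).comp_hasDerivWithinAt t hs.neg.exp).smul hθ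

theorem condFactor_polarCurve (hunit : ‖θ t‖ = 1) : condFactor {0} (polarCurve s θ t) =
    Real.exp (s t) * (2 / (1 - tanhHalf (Real.exp (-s t)) ^ 2)) := by
  rw [condFactor_zero (polarCurve_mem hunit), norm_polarCurve hunit, hypRadius_tanhHalf,
    polarCurve, hypFactor_smul_tanhHalf hunit, ← Real.exp_neg, neg_neg]

/-- The speed of a curve in polar coordinates, for the condition metric. -/
theorem condSpeed_polarCurve_sq {s' : ℝ} {θ' : E n} (hs : HasDerivAt s s' t)
    (hθ : HasDerivAt θ θ' t) (hunit : ∀ᶠ x in 𝓝 t, ‖θ x‖ = 1) :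
    (condFactor {0} (polarCurve s θ t) * ‖deriv (polarCurve s θ) t‖) ^ 2
      = s' ^ 2 + warp (s t) ^ 2 * ‖θ'‖ ^ 2 := by
  have hu := hunit.self_of_nhds
  have horth := inner_deriv_eq_zero_of_norm_eq_one hθ hunit
  have hd := (hasDerivWithinAt_polarCurve (S := univ) hs.hasDerivWithinAt hθ.hasDerivWithinAt)
  rw [hasDerivWithinAt_univ] at hd
  rw [hd.deriv, condFactor_polarCurve hu, mul_pow, norm_add_sq_real, inner_smul_left,
    inner_smul_right, real_inner_comm, horth, norm_smul, norm_smul, hu]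
  simp only [mul_pow, Real.norm_eq_abs, sq_abs, mul_zero, add_zero, mul_one]
  have hwarp : warp (s t) = Real.exp (s t) * (2 / (1 - tanhHalf (Real.exp (-s t)) ^ 2)) *
      tanhHalf (Real.exp (-s t)) := by
    have hp := Real.exp_pos (Real.exp (-s t))
    rw [one_sub_tanhHalf_sq, tanhHalf, warp, Real.sinh_eq, Real.exp_neg (Real.exp (-s t))]
    field_simp
    ring
  have hone : Real.exp (s t) * Real.exp (-s t) = 1 := by rw [← Real.exp_add]; simp
  have h0 := (one_sub_tanhHalf_sq_pos (Real.exp (-s t))).ne'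
  rw [hwarp]
  have h5 : Real.exp (s t) * (2 / (1 - tanhHalf (Real.exp (-s t)) ^ 2)) *
      ((1 - tanhHalf (Real.exp (-s t)) ^ 2) / 2 * (Real.exp (-s t) * -s')) = -s' := by
    field_simp
    linear_combination -s' * hone
  calc _ = (Real.exp (s t) * (2 / (1 - tanhHalf (Real.exp (-s t)) ^ 2)) *
        ((1 - tanhHalf (Real.exp (-s t)) ^ 2) / 2 * (Real.exp (-s t) * -s'))) ^ 2 +
        (Real.exp (s t) * (2 / (1 - tanhHalf (Real.exp (-s t)) ^ 2)) *
      tanhHalf (Real.exp (-s t))) ^ 2 * ‖θ'‖ ^ 2 := by ring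
    _ = _ := by rw [h5]; ring

/-- The logarithmic polar coordinate `s` of a point of the punctured ball. -/
noncomputable def logRadius (x : E n) : ℝ := -Real.log (hypRadius ‖x‖)

theorem polarCurve_logRadius {c : ℝ → E n} (hc : c t ∈ hypSpace n \ {0}) :
    polarCurve (fun t => logRadius (c t)) (fun t => ‖c t‖⁻¹ • c t) t = c t := by
  obtain ⟨h0, h1⟩ := norm_pos_and_lt_one hc
  simp only [polarCurve, logRadius]
  rw [neg_neg, Real.exp_log (hypRadius_pos h0 h1), tanhHalf_hypRadius h0.le h1, smul_smul,
    mul_inv_cancel₀ h0.ne', one_smul]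

theorem lipOn_logRadius {c : ℝ → E n} (hc : IsLipschitzCurve (hypSpace n \ {0}) c a b) :
    LipOn (fun t => logRadius (c t)) a b := by
  refine LipOn.comp_contDiffAt (g := logRadius) hc.1 fun t ht => ?_
  obtain ⟨h0, h1⟩ := norm_pos_and_lt_one (hc.2 ht)
  exact (((contDiffAt_hypRadius h0.le h1).comp (c t) (contDiffAt_norm ℝ (norm_pos_iff.1 h0))).log
    (hypRadius_pos h0 h1).ne').neg

theorem lipOn_direction {c : ℝ → E n} (hc : IsLipschitzCurve (hypSpace n \ {0}) c a b) :
    LipOn (fun t => ‖c t‖⁻¹ • c t) a b := by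
  refine LipOn.comp_contDiffAt (g := fun x : E n => ‖x‖⁻¹ • x) hc.1 fun t ht => ?_
  obtain ⟨h0, h1⟩ := norm_pos_and_lt_one (hc.2 ht)
  exact ((contDiffAt_norm ℝ (norm_pos_iff.1 h0)).inv h0.ne').smul contDiffAt_id

theorem norm_direction {x : E n} (hx : x ∈ hypSpace n \ {0}) : ‖‖x‖⁻¹ • x‖ = 1 := by
  obtain ⟨h0, -⟩ := norm_pos_and_lt_one hx
  rw [norm_smul, norm_inv, norm_norm, inv_mul_cancel₀ h0.ne']

theorem ae_condSpeed_polarCurve_sq (hs : LipOn s a b) (hθ : LipOn θ a b)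
    (hunit : ∀ t ∈ Icc a b, ‖θ t‖ = 1) :
    ∀ᵐ t ∂(volume.restrict (Ioc a b)),
      (condFactor {0} (polarCurve s θ t) * ‖deriv (polarCurve s θ) t‖) ^ 2
        = warpedSpeedSq warp s θ t := by
  filter_upwards [hs.ae_hasDerivAt, hθ.ae_hasDerivAt, ae_mem_Ioo a b] with t h1 h2 ht
  rw [condSpeed_polarCurve_sq h1 h2 ?_, warpedSpeedSq]
  filter_upwards [Icc_mem_nhds ht.1 ht.2] with x hx using hunit x hx

theorem ae_condSpeed_sq {c : ℝ → E n} (hc : IsLipschitzCurve (hypSpace n \ {0}) c a b) :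
    ∀ᵐ t ∂(volume.restrict (Ioc a b)), (condFactor {0} (c t) * ‖deriv c t‖) ^ 2
      = warpedSpeedSq warp (fun t => logRadius (c t)) (fun t => ‖c t‖⁻¹ • c t) t := by
  filter_upwards [ae_condSpeed_polarCurve_sq (lipOn_logRadius hc) (lipOn_direction hc)
    fun t ht => norm_direction (hc.2 ht), ae_mem_Ioo a b] with t h1 ht
  rw [← h1, polarCurve_logRadius (hc.2 (Ioo_subset_Icc_self ht))]
  have h2 : polarCurve (fun t => logRadius (c t)) (fun t => ‖c t‖⁻¹ • c t) =ᶠ[𝓝 t] c := by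
    filter_upwards [Icc_mem_nhds ht.1 ht.2] with x hx using polarCurve_logRadius (hc.2 hx)
  rw [h2.deriv_eq]

/-- A minimizing geodesic has unit speed. -/
theorem IsMinimizingGeodesic.ae_speed_eq_one {w : E n → ℝ} {M : Set (E n)} {γ : ℝ → E n}
    (hw : ContinuousOn w M) (hγ : IsMinimizingGeodesic w M γ a b) :
    ∀ᵐ t ∂(volume.restrict (Ioc a b)), w (γ t) * ‖deriv γ t‖ = 1 := by
  filter_upwards [(essBdd_speed hw hγ.curve).ae_hasDerivAt_integral hγ.lt.le, ae_mem_Ioo a b]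
    with t h1 ht
  refine h1.unique (((hasDerivAt_id t).sub_const a).congr_of_eventuallyEq ?_)
  filter_upwards [Icc_mem_nhds ht.1 ht.2] with x hx
  exact hγ.arcLength a x le_rfl hx.1 hx.2

/-- Minimizing geodesics of the condition metric minimize the energy, in polar coordinates. -/
theorem IsMinimizingGeodesic.isEnergyMinimizer {γ : ℝ → E n}
    (hγ : IsMinimizingGeodesic (condFactor {0}) (hypSpace n \ {0}) γ a b) :
    IsEnergyMinimizer warp (fun t => logRadius (γ t)) (fun t => ‖γ t‖⁻¹ • γ t) a b where
  lip_fst := lipOn_logRadius hγ.curve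
  lip_snd := lipOn_direction hγ.curve
  norm_snd t ht := norm_direction (hγ.curve.2 ht)
  le σ η hσ hη hunit hσa hσb hηa hηb := by
    have hab := hγ.lt.le
    have h1 : ∫ t in a..b, warpedSpeedSq warp (fun t => logRadius (γ t))
        (fun t => ‖γ t‖⁻¹ • γ t) t = ∫ t in a..b, (1 : ℝ) := by
      refine intervalIntegral_congr_ae_restrict hab ?_
      filter_upwards [ae_condSpeed_sq hγ.curve, hγ.ae_speed_eq_one continuousOn_condFactor_zero]
        with t h2 h3
      rw [← h2, h3, one_pow]
    have hc := isLipschitzCurve_polarCurve hσ hη hunit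
    have hend : ∀ t ∈ Icc a b, σ t = logRadius (γ t) → η t = ‖γ t‖⁻¹ • γ t →
        polarCurve σ η t = γ t := by
      intro t ht h1 h2
      rw [← polarCurve_logRadius (hγ.curve.2 ht), polarCurve, h1, h2, polarCurve]
    have h2 := hγ.minimizing _ hc (hend a (left_mem_Icc.2 hab) hσa hηa)
      (hend b (right_mem_Icc.2 hab) hσb hηb)
    have hW : EssBdd (warpedSpeedSq warp σ η) a b := .warpedSpeedSq contDiff_warp.continuous hσ hη
    -- Compare length and energy through `2 v ≤ v² + 1`, an equality at unit speed.
    have h3 := (essBdd_speed continuousOn_condFactor_zero hc).integral_mono hab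
      ((EssBdd.const (1 / 2) a b).mul (hW.add (.const 1 a b))) (by
        filter_upwards [ae_condSpeed_polarCurve_sq hσ hη hunit] with t h4
        rw [← h4]
        nlinarith [sq_nonneg (condFactor {0} (polarCurve σ η t) * ‖deriv (polarCurve σ η) t‖ - 1)])
    rw [hγ.arcLength a b le_rfl hab le_rfl] at h2
    rw [intervalIntegral.integral_const_mul, intervalIntegral.integral_add
      (hW.intervalIntegrable hab) (by simp)] at h3
    simp only [intervalIntegral.integral_const, smul_eq_mul, mul_one] at h1 h3
    rw [length] at h2
    linarith

end Polar

/-! ### From local to global second derivatives -/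

section Calculus

/-- On `[a, b]`, the function `F` has first derivative `q` and continuous second derivative `g`. -/
structure HasSecondDerivOn (F q g : ℝ → ℝ) (a b : ℝ) : Prop where
  lt : a < b
  fst : ∀ t ∈ Icc a b, HasDerivWithinAt F (q t) (Icc a b) t
  snd : ∀ t ∈ Icc a b, HasDerivWithinAt q (g t) (Icc a b) t
  cont : ContinuousOn g (Icc a b)

namespace HasSecondDerivOn

variable {F q g : ℝ → ℝ} {a b t : ℝ} {I : Set ℝ}

theorem contDiffOn (h : HasSecondDerivOn F q g a b) : ContDiffOn ℝ 2 F (Icc a b) := by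
  have hu := uniqueDiffOn_Icc h.lt
  have h2 : ContDiffOn ℝ 1 q (Icc a b) := by
    rw [show (1 : WithTop ℕ∞) = 0 + 1 by simp, contDiffOn_succ_iff_derivWithin hu]
    refine ⟨fun t ht => (h.snd t ht).differentiableWithinAt, by simp, contDiffOn_zero.2 ?_⟩
    exact h.cont.congr fun t ht => (h.snd t ht).derivWithin (hu t ht)
  rw [show (2 : WithTop ℕ∞) = 1 + 1 by norm_num, contDiffOn_succ_iff_derivWithin hu]
  exact ⟨fun t ht => (h.fst t ht).differentiableWithinAt, by simp,
    h2.congr fun t ht => (h.fst t ht).derivWithin (hu t ht)⟩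

theorem iteratedDerivWithin_eq (h : HasSecondDerivOn F q g a b) (ht : t ∈ Icc a b)
    (hI : Icc a b ⊆ I) (hn : Icc a b ∈ 𝓝[I] t) (hu : UniqueDiffOn ℝ I) :
    iteratedDerivWithin 2 F I t = g t := by
  have h1 : derivWithin F I =ᶠ[𝓝[I] t] q := by
    filter_upwards [eventually_eventually_nhdsWithin.2 hn, hn] with x hx hx'
    exact ((h.fst x hx').mono_of_mem_nhdsWithin hx).derivWithin (hu x (hI hx'))
  rw [iteratedDerivWithin_succ, iteratedDerivWithin_one,
    h1.derivWithin_eq_of_mem (hI ht)]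
  exact ((h.snd t ht).mono_of_mem_nhdsWithin hn).derivWithin (hu t (hI ht))

theorem deriv2_eq (h : HasSecondDerivOn F q g a b) (ht : t ∈ Ioo a b) :
    deriv^[2] F t = g t := by
  have h1 : deriv F =ᶠ[𝓝 t] q := by
    filter_upwards [Ioo_mem_nhds ht.1 ht.2] with x hx
    exact ((h.fst x (Ioo_subset_Icc_self hx)).hasDerivAt (Icc_mem_nhds hx.1 hx.2)).deriv
  have h2 := (h.snd t (Ioo_subset_Icc_self ht)).hasDerivAt (Icc_mem_nhds ht.1 ht.2)
  simp only [Function.iterate_succ, Function.iterate_zero, Function.comp_apply, id]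
  rw [h1.deriv_eq, h2.deriv]

theorem exists_strictConcaveOn (h : HasSecondDerivOn F q g a b) (ht : t ∈ Icc a b)
    (hn : Icc a b ∈ 𝓝[I] t) (hI : Convex ℝ I) (hg : g t < 0) :
    ∃ ε : ℝ, 0 < ε ∧ StrictConcaveOn ℝ (I ∩ Ioo (t - ε) (t + ε)) F := by
  have h1 : {x | x ∈ Icc a b ∧ g x < 0} ∈ 𝓝[I] t := by
    have h2 : ∀ᶠ x in 𝓝[Icc a b] t, g x < 0 := (h.cont t ht).eventually (gt_mem_nhds hg)
    have h3 : 𝓝[I] t ≤ 𝓝[Icc a b] t := nhdsWithin_le_of_mem hn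
    filter_upwards [h3 h2, hn] with x hx hx' using ⟨hx', hx⟩
  obtain ⟨ε, hε, hsub⟩ := Metric.mem_nhdsWithin_iff.1 h1
  rw [Real.ball_eq_Ioo, inter_comm] at hsub
  refine ⟨ε, hε, strictConcaveOn_of_deriv2_neg (hI.inter (convex_Ioo _ _)) ?_ ?_⟩
  · exact h.contDiffOn.continuousOn.mono fun x hx => (hsub hx).1
  · intro x hx
    have hx1 : x ∈ Ioo a b := by
      rw [← interior_Icc]
      exact interior_mono (fun y hy => (hsub hy).1) hx
    rw [h.deriv2_eq hx1]
    exact (hsub (interior_subset hx)).2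

/-- A function which near every point of an interval has a nonpositive second derivative is
concave. -/
theorem concaveOn_of_local (hI : Convex ℝ I) (h : ∀ t ∈ I, ∃ a b q g, t ∈ Icc a b ∧
    Icc a b ∈ 𝓝[I] t ∧ HasSecondDerivOn F q g a b ∧ g t ≤ 0) : ConcaveOn ℝ I F := by
  have hloc : ∀ t ∈ interior I, ∃ a b q g, t ∈ Ioo a b ∧ HasSecondDerivOn F q g a b ∧
      g t ≤ 0 := by
    intro t ht
    obtain ⟨a, b, q, g, -, hn, h1, h2⟩ := h t (interior_subset ht)
    rw [nhdsWithin_eq_nhds.2 (mem_interior_iff_mem_nhds.1 ht)] at hn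
    exact ⟨a, b, q, g, Icc_mem_nhds_iff.1 hn, h1, h2⟩
  refine concaveOn_of_deriv2_nonpos hI ?_ ?_ ?_ ?_
  · intro t ht
    obtain ⟨a, b, q, g, h0, hn, h1, -⟩ := h t ht
    exact (h1.contDiffOn.continuousOn t h0).mono_of_mem_nhdsWithin hn
  · intro t ht
    obtain ⟨a, b, q, g, h0, h1, -⟩ := hloc t ht
    exact ((h1.fst t (Ioo_subset_Icc_self h0)).hasDerivAt
      (Icc_mem_nhds h0.1 h0.2)).differentiableAt.differentiableWithinAt
  · intro t ht
    obtain ⟨a, b, q, g, h0, h1, -⟩ := hloc t ht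
    have h2 : deriv F =ᶠ[𝓝 t] q := by
      filter_upwards [Ioo_mem_nhds h0.1 h0.2] with x hx
      exact ((h1.fst x (Ioo_subset_Icc_self hx)).hasDerivAt (Icc_mem_nhds hx.1 hx.2)).deriv
    have h3 := ((h1.snd t (Ioo_subset_Icc_self h0)).hasDerivAt (Icc_mem_nhds h0.1 h0.2))
    exact (h3.congr_of_eventuallyEq h2).differentiableAt.differentiableWithinAt
  · intro t ht
    obtain ⟨a, b, q, g, h0, h1, h2⟩ := hloc t ht
    rwa [h1.deriv2_eq h0]

end HasSecondDerivOn

end Calculus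

/-! ### Geodesics of the condition metric of the centre -/

section CentreGeodesics

variable {n : ℕ} {γ : ℝ → E n} {a b t : ℝ} {I : Set ℝ}

/-- The second derivative of `log (1 / d(γ(t), 0))` is `f f' |θ'|²`, with `f = warp` and `θ` the
direction of `γ`; where `θ'` vanishes, the velocity of `γ` is radial. -/
theorem IsMinimizingGeodesic.exists_hasSecondDerivOn
    (hγ : IsMinimizingGeodesic (condFactor {0}) (hypSpace n \ {0}) γ a b) :
    ∃ (q : ℝ → ℝ) (m γ' : ℝ → E n),
      HasSecondDerivOn (logInvDist {0} γ) q
        (fun t => warp (logRadius (γ t)) * deriv warp (logRadius (γ t)) * ‖m t‖ ^ 2) a b ∧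
      (∀ t ∈ Icc a b, HasDerivWithinAt γ (γ' t) (Icc a b) t) ∧
      ∀ t, m t = 0 → ∃ k : ℝ, γ' t = k • γ t := by
  obtain ⟨q, m, hm, hθ, hs, hq⟩ := hγ.isEnergyMinimizer.exists_hasDerivWithinAt contDiff_warp
    (fun x => zero_lt_one.trans (one_lt_warp x)) hγ.lt
  have hs0 : ContinuousOn (fun t => logRadius (γ t)) (Icc a b) :=
    fun t ht => (hs t ht).continuousWithinAt
  have hlog : ∀ t ∈ Icc a b, logInvDist {0} γ t = logRadius (γ t) := fun t ht =>
    logInvDist_zero (hγ.curve.2 ht)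
  refine ⟨q, m, _, ⟨hγ.lt, fun t ht => (hs t ht).congr hlog (hlog t ht), hq, ?_⟩, fun t ht =>
    (hasDerivWithinAt_polarCurve (hs t ht) (hθ t ht)).congr
      (fun x hx => (polarCurve_logRadius (hγ.curve.2 hx)).symm)
      (polarCurve_logRadius (hγ.curve.2 ht)).symm, fun t ht => ?_⟩
  · exact ((contDiff_warp.continuous.comp_continuousOn hs0).mul
      ((contDiff_warp.continuous_deriv (by norm_num)).comp_continuousOn hs0)).mul (hm.norm.pow 2)
  · rw [ht, smul_zero, zero_add, smul_smul]
    exact ⟨_, rfl⟩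

/-- The hyperbolic geodesics through the centre are the Euclidean diameters, so a multiple of the
position vector is radial. -/
theorem isRadial_zero {x v : E n} (hx : x ∈ hypSpace n \ {0}) {k : ℝ} (hv : v = k • x) :
    IsRadial 0 x v := by
  obtain ⟨h0, h1⟩ := norm_pos_and_lt_one hx
  set l := hypRadius ‖x‖ with hl
  have hxl : tanhHalf l • (‖x‖⁻¹ • x) = x := by
    rw [tanhHalf_hypRadius h0.le h1, smul_smul, mul_inv_cancel₀ h0.ne', one_smul]
  refine ⟨_, l, _, isMinimizingGeodesic_ray (norm_direction hx) (hypRadius_pos h0 h1), ?_, ?_,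
    (hasDerivAt_ray (‖x‖⁻¹ • x) l 1 0).hasDerivWithinAt,
    k * (-(‖x‖ * 2 / (1 - tanhHalf l ^ 2))), ?_⟩
  · simpa using hxl
  · simp [tanhHalf_zero]
  · have h2 := (one_sub_tanhHalf_sq_pos l).ne'
    rw [hv, smul_smul, smul_smul, mul_zero, sub_zero]
    congr 1
    field_simp

theorem IsCondGeodesic.mem {N : Set (E n)} (hγ : IsCondGeodesic N γ I) (ht : t ∈ I) :
    γ t ∈ hypSpace n \ N := by
  obtain ⟨a, b, h, -, -, h'⟩ := hγ.2 t ht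
  exact h'.curve.2 h

theorem IsCondGeodesic.uniqueDiffOn {N : Set (E n)} (hγ : IsCondGeodesic N γ I) :
    UniqueDiffOn ℝ I := by
  intro t ht
  obtain ⟨a, b, h, hsub, -, h'⟩ := hγ.2 t ht
  exact (uniqueDiffOn_Icc h'.lt t h).mono hsub

/-- Concavity and regularity along the geodesics of the condition metric of the centre. -/
theorem IsCondGeodesic.concaveOn_and_strictConcaveOn (hγ : IsCondGeodesic {0} γ I) :
    ConcaveOn ℝ I (logInvDist {0} γ) ∧ DifferentiableOn ℝ γ I ∧
      ContDiffOn ℝ 2 (logInvDist {0} γ) I ∧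
      ∀ t ∈ I, ¬ IsRadial 0 (γ t) (derivWithin γ I t) →
        iteratedDerivWithin 2 (logInvDist {0} γ) I t < 0 ∧
        ∃ ε : ℝ, 0 < ε ∧ StrictConcaveOn ℝ (I ∩ Ioo (t - ε) (t + ε)) (logInvDist {0} γ) := by
  have hconv : Convex ℝ I := hγ.1.convex
  have hneg : ∀ s, warp s * deriv warp s < 0 := fun s =>
    mul_neg_of_pos_of_neg (zero_lt_one.trans (one_lt_warp s)) (deriv_warp_neg s)
  refine ⟨HasSecondDerivOn.concaveOn_of_local hconv fun t ht => ?_, fun t ht => ?_,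
    fun t ht => ?_, fun t ht hrad => ?_⟩ <;>
  obtain ⟨a, b, hab, hsub, hn, hmin⟩ := hγ.2 t ht <;>
  obtain ⟨q, m, γ', h2, hγ', hrad'⟩ := hmin.exists_hasSecondDerivOn
  · exact ⟨a, b, q, _, hab, hn, h2,
      mul_nonpos_of_nonpos_of_nonneg (hneg _).le (sq_nonneg _)⟩
  · exact ((hγ' t hab).mono_of_mem_nhdsWithin hn).differentiableWithinAt
  · exact (h2.contDiffOn t hab).mono_of_mem_nhdsWithin hn
  · have hm : m t ≠ 0 := by
      intro hm
      obtain ⟨k, hk⟩ := hrad' t hm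
      refine hrad (isRadial_zero (hγ.mem ht) (k := k) ?_)
      rw [((hγ' t hab).mono_of_mem_nhdsWithin hn).derivWithin (hγ.uniqueDiffOn t ht), hk]
    have hlt := mul_neg_of_neg_of_pos (hneg (logRadius (γ t))) (pow_pos (norm_pos_iff.2 hm) 2)
    exact ⟨by rwa [h2.iteratedDerivWithin_eq hab hsub hn hγ.uniqueDiffOn],
      h2.exists_strictConcaveOn hab hn hconv hlt⟩

end CentreGeodesics

/-! ### Isometries of hyperbolic space -/

section Isometry

variable {n : ℕ}

/-- `Φ` is an involutive isometry of the ball model of hyperbolic space. -/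
structure IsHypInvolution (Φ : E n → E n) : Prop where
  mapsTo : MapsTo Φ (hypSpace n) (hypSpace n)
  apply_apply : ∀ x ∈ hypSpace n, Φ (Φ x) = x
  contDiffAt : ∀ x ∈ hypSpace n, ContDiffAt ℝ 1 Φ x
  conformal : ∀ x ∈ hypSpace n, ∀ v, hypFactor (Φ x) * ‖fderiv ℝ Φ x v‖ = hypFactor x * ‖v‖

namespace IsHypInvolution

variable {Φ : E n → E n} {w w' : E n → ℝ} {M M' : Set (E n)} {c γ : ℝ → E n} {a b : ℝ}
  {p x : E n}

theorem hasFDerivAt (hΦ : IsHypInvolution Φ) (hx : x ∈ hypSpace n) :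
    HasFDerivAt Φ (fderiv ℝ Φ x) x :=
  ((hΦ.contDiffAt x hx).differentiableAt one_ne_zero).hasFDerivAt

theorem isLipschitzCurve_comp (hΦ : IsHypInvolution Φ) (hM : M ⊆ hypSpace n)
    (hMM' : MapsTo Φ M M') (hc : IsLipschitzCurve M c a b) :
    IsLipschitzCurve M' (fun t => Φ (c t)) a b :=
  ⟨LipOn.comp_contDiffAt hc.1 fun _ ht => hΦ.contDiffAt _ (hM (hc.2 ht)),
    fun _ ht => hMM' (hc.2 ht)⟩

theorem length_comp (hΦ : IsHypInvolution Φ) (hM : M ⊆ hypSpace n)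
    (hw : ∀ x ∈ M, ∀ v, w' (Φ x) * ‖fderiv ℝ Φ x v‖ = w x * ‖v‖) (hab : a ≤ b)
    (hc : IsLipschitzCurve M c a b) : length w' (fun t => Φ (c t)) a b = length w c a b := by
  refine intervalIntegral_congr_ae_restrict hab ?_
  filter_upwards [LipOn.ae_hasDerivAt hc.1, ae_mem_Ioo a b] with t h1 ht
  have hm := hc.2 (Ioo_subset_Icc_self ht)
  have h2 : HasDerivAt (fun t => Φ (c t)) (fderiv ℝ Φ (c t) (deriv c t)) t :=
    (hΦ.hasFDerivAt (hM hm)).comp_hasDerivAt t h1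
  rw [h2.deriv, hw _ hm]

theorem isMinimizingGeodesic_comp (hΦ : IsHypInvolution Φ) (hM : M ⊆ hypSpace n)
    (hM' : M' ⊆ hypSpace n) (hMM' : MapsTo Φ M M') (hM'M : MapsTo Φ M' M)
    (hw : ∀ x ∈ M, ∀ v, w' (Φ x) * ‖fderiv ℝ Φ x v‖ = w x * ‖v‖)
    (hw' : ∀ x ∈ M', ∀ v, w (Φ x) * ‖fderiv ℝ Φ x v‖ = w' x * ‖v‖)
    (hγ : IsMinimizingGeodesic w M γ a b) :
    IsMinimizingGeodesic w' M' (fun t => Φ (γ t)) a b where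
  lt := hγ.lt
  curve := hΦ.isLipschitzCurve_comp hM hMM' hγ.curve
  arcLength s t hs hst ht := by
    rw [hΦ.length_comp hM hw hst ⟨LipOn.mono hγ.curve.1 hs ht,
      hγ.curve.2.mono_left (Icc_subset_Icc hs ht)⟩]
    exact hγ.arcLength s t hs hst ht
  minimizing c hc hca hcb := by
    have hab := hγ.lt.le
    rw [hΦ.length_comp hM hw hab hγ.curve, ← hΦ.length_comp hM' hw' hab hc]
    refine hγ.minimizing _ (hΦ.isLipschitzCurve_comp hM' hM'M hc) ?_ ?_
    · simp only [hca, hΦ.apply_apply _ (hM (hγ.curve.2 (left_mem_Icc.2 hab)))]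
    · simp only [hcb, hΦ.apply_apply _ (hM (hγ.curve.2 (right_mem_Icc.2 hab)))]

theorem hypDist_apply (hΦ : IsHypInvolution Φ) {x y : E n} (hx : x ∈ hypSpace n)
    (hy : y ∈ hypSpace n) : hypDist (Φ x) (Φ y) = hypDist x y := by
  have key : ∀ x y : E n,
      {L : ℝ | ∃ c : ℝ → E n, IsLipschitzCurve (hypSpace n) c 0 1 ∧ c 0 = x ∧ c 1 = y ∧
        L = length hypFactor c 0 1} ⊆
      {L : ℝ | ∃ c : ℝ → E n, IsLipschitzCurve (hypSpace n) c 0 1 ∧ c 0 = Φ x ∧ c 1 = Φ y ∧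
        L = length hypFactor c 0 1} := by
    rintro x y L ⟨c, hc, rfl, rfl, rfl⟩
    exact ⟨fun t => Φ (c t), hΦ.isLipschitzCurve_comp subset_rfl hΦ.mapsTo hc, rfl, rfl,
      (hΦ.length_comp subset_rfl hΦ.conformal zero_le_one hc).symm⟩
  have h1 := key (Φ x) (Φ y)
  rw [hΦ.apply_apply x hx, hΦ.apply_apply y hy] at h1
  exact congrArg sInf (h1.antisymm (key x y))

theorem condFactor_apply (hΦ : IsHypInvolution Φ) (hp : p ∈ hypSpace n) (hx : x ∈ hypSpace n)
    (v : E n) : condFactor {Φ p} (Φ x) * ‖fderiv ℝ Φ x v‖ = condFactor {p} x * ‖v‖ := by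
  rw [condFactor, condFactor, distTo_singleton, distTo_singleton, hΦ.hypDist_apply hx hp,
    mul_assoc, mul_assoc, hΦ.conformal x hx]

theorem logInvDist_comp {t : ℝ} (hΦ : IsHypInvolution Φ) (hp : p ∈ hypSpace n)
    (ht : γ t ∈ hypSpace n) :
    logInvDist {Φ p} (fun t => Φ (γ t)) t = logInvDist {p} γ t := by
  rw [logInvDist, logInvDist, distTo_singleton, distTo_singleton, hΦ.hypDist_apply ht hp]

theorem mapsTo_diff (hΦ : IsHypInvolution Φ) (hp : p ∈ hypSpace n) :
    MapsTo Φ (hypSpace n \ {p}) (hypSpace n \ {Φ p}) := by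
  refine fun x hx => ⟨hΦ.mapsTo hx.1, fun h => hx.2 ?_⟩
  rw [mem_singleton_iff] at h ⊢
  rw [← hΦ.apply_apply x hx.1, h, hΦ.apply_apply p hp]

theorem isCondGeodesic_comp (hΦ : IsHypInvolution Φ) (hp : p ∈ hypSpace n) {I : Set ℝ}
    (hγ : IsCondGeodesic {p} γ I) : IsCondGeodesic {Φ p} (fun t => Φ (γ t)) I := by
  refine ⟨hγ.1, fun t ht => ?_⟩
  obtain ⟨a, b, h1, h2, h3, h4⟩ := hγ.2 t ht
  have hmaps := hΦ.mapsTo_diff (hΦ.mapsTo hp)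
  have hconf := fun x hx => hΦ.condFactor_apply (x := x) (hΦ.mapsTo hp) hx
  rw [hΦ.apply_apply p hp] at hmaps hconf
  exact ⟨a, b, h1, h2, h3, hΦ.isMinimizingGeodesic_comp sdiff_subset sdiff_subset
    (hΦ.mapsTo_diff hp) hmaps (fun x hx => hΦ.condFactor_apply hp hx.1)
    (fun x hx => hconf x hx.1) h4⟩

theorem isRadial_apply (hΦ : IsHypInvolution Φ) (hx : x ∈ hypSpace n) {v : E n}
    (h : IsRadial p x v) : IsRadial (Φ p) (Φ x) (fderiv ℝ Φ x v) := by
  obtain ⟨σ, l, u, hσ, h0, hl, hu, k, rfl⟩ := h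
  refine ⟨fun t => Φ (σ t), l, fderiv ℝ Φ x u, hΦ.isMinimizingGeodesic_comp subset_rfl subset_rfl
    hΦ.mapsTo hΦ.mapsTo hΦ.conformal hΦ.conformal hσ, congrArg Φ h0, congrArg Φ hl, ?_, k, by simp⟩
  subst h0
  exact (hΦ.hasFDerivAt hx).comp_hasDerivWithinAt 0 hu

theorem isHypInvolution_id : IsHypInvolution (id : E n → E n) where
  mapsTo := fun _ hx => hx
  apply_apply _ _ := rfl
  contDiffAt _ _ := contDiffAt_id
  conformal x _ v := by simp

end IsHypInvolution

theorem one_sub_norm_inversion_sq {c x : E n} {R : ℝ} (hR : R ^ 2 = ‖c‖ ^ 2 - 1) (hx : x ≠ c) :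
    1 - ‖EuclideanGeometry.inversion c R x‖ ^ 2 = (R / dist x c) ^ 2 * (1 - ‖x‖ ^ 2) := by
  have hd : dist x c ≠ 0 := dist_ne_zero.2 hx
  have h1 : ‖x‖ ^ 2 = dist x c ^ 2 + 2 * inner ℝ (x - c) c + ‖c‖ ^ 2 := by
    rw [dist_eq_norm, ← norm_add_sq_real, sub_add_cancel]
  have h2 : (R / dist x c) ^ 2 * dist x c ^ 2 = R ^ 2 := by field_simp
  rw [EuclideanGeometry.inversion, vsub_eq_sub, vadd_eq_add, norm_add_sq_real, norm_smul,
    inner_smul_left, mul_pow, ← dist_eq_norm]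
  simp only [Real.norm_eq_abs, sq_abs, map_pow, conj_trivial, abs_pow]
  linear_combination (R / dist x c) ^ 2 * h1 + (1 - (R / dist x c) ^ 2) * h2 +
    (1 - (R / dist x c) ^ 2) * hR

/-- Inversion in a sphere orthogonal to the unit sphere is a hyperbolic isometry. -/
theorem isHypInvolution_inversion {c : E n} {R : ℝ} (hR : R ^ 2 = ‖c‖ ^ 2 - 1) (hR0 : 0 < R) :
    IsHypInvolution (EuclideanGeometry.inversion c R) := by
  have hc : 1 < ‖c‖ := by nlinarith [norm_nonneg c, sq_pos_of_pos hR0]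
  have hne : ∀ x ∈ hypSpace n, x ≠ c := by
    rintro x hx rfl
    exact absurd (mem_hypSpace.1 hx) (by linarith)
  have hk : ∀ x ∈ hypSpace n, 0 < (R / dist x c) ^ 2 := fun x hx =>
    pow_pos (div_pos hR0 (dist_pos.2 (hne x hx))) 2
  have hn : ∀ x ∈ hypSpace n, 0 < 1 - ‖x‖ ^ 2 := fun x hx => by
    have := mem_hypSpace.1 hx
    nlinarith [norm_nonneg x]
  refine ⟨fun x hx => ?_, fun x _ => EuclideanGeometry.inversion_inversion c hR0.ne' x,
    fun x hx => contDiffAt_const.inversion contDiffAt_const contDiffAt_id (hne x hx),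
    fun x hx v => ?_⟩
  · rw [mem_hypSpace]
    have := one_sub_norm_inversion_sq hR (hne x hx)
    have h2 := mul_pos (hk x hx) (hn x hx)
    nlinarith [norm_nonneg (EuclideanGeometry.inversion c R x)]
  · rw [hypFactor, hypFactor, one_sub_norm_inversion_sq hR (hne x hx),
      (EuclideanGeometry.hasFDerivAt_inversion (hne x hx)).fderiv]
    have h1 := (hk x hx).ne'
    have h2 := (hn x hx).ne'
    have h3 := dist_ne_zero.2 (hne x hx)
    simp only [_root_.smul_apply, norm_smul]
    rw [Real.norm_of_nonneg (hk x hx).le]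
    simp only [LinearIsometryEquiv.coe_coe'', LinearIsometryEquiv.norm_map]
    field_simp

/-- Every point of the ball can be moved to the centre: for `p ≠ 0` by the inversion in the sphere
with centre `p / ‖p‖²` that is orthogonal to the unit sphere. -/
theorem exists_isHypInvolution {p : E n} (hp : p ∈ hypSpace n) :
    ∃ Φ : E n → E n, IsHypInvolution Φ ∧ Φ p = 0 := by
  by_cases hp0 : p = 0
  · exact ⟨id, .isHypInvolution_id, hp0⟩
  have h0 : 0 < ‖p‖ := norm_pos_iff.2 hp0
  have h1 : ‖p‖ < 1 := mem_hypSpace.1 hp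
  set c : E n := (‖p‖ ^ 2)⁻¹ • p with hc
  have hcn : ‖c‖ ^ 2 = (‖p‖ ^ 2)⁻¹ := by
    rw [hc, norm_smul, Real.norm_of_nonneg (by positivity)]
    field_simp
  have hpos : 0 < (‖p‖ ^ 2)⁻¹ - 1 := sub_pos.2 ((one_lt_inv₀ (by positivity)).2 (by nlinarith))
  have hR : Real.sqrt ((‖p‖ ^ 2)⁻¹ - 1) ^ 2 = ‖c‖ ^ 2 - 1 := by rw [Real.sq_sqrt hpos.le, hcn]
  have hpc : p - c = (1 - (‖p‖ ^ 2)⁻¹) • p := by rw [hc, sub_smul, one_smul]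
  have hne : p ≠ c := by
    intro h
    rw [← h] at hcn
    have : ‖p‖ ^ 2 < 1 := by nlinarith
    linarith
  refine ⟨_, isHypInvolution_inversion hR (Real.sqrt_pos.2 hpos), ?_⟩
  have h2 := one_sub_norm_inversion_sq hR hne
  have h3 : dist p c ^ 2 = ((‖p‖ ^ 2)⁻¹ - 1) ^ 2 * ‖p‖ ^ 2 := by
    rw [dist_eq_norm, hpc, norm_smul, mul_pow, Real.norm_eq_abs, sq_abs]
    ring
  rw [div_pow, h3, Real.sq_sqrt hpos.le] at h2
  have h4 : ((‖p‖ ^ 2)⁻¹ - 1) / (((‖p‖ ^ 2)⁻¹ - 1) ^ 2 * ‖p‖ ^ 2) * (1 - ‖p‖ ^ 2) = 1 := by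
    have h5 := hpos.ne'
    rw [div_mul_eq_mul_div, div_eq_one_iff_eq (by positivity)]
    field_simp
  rw [h4] at h2
  rw [← norm_eq_zero]
  nlinarith

end Isometry

/-! ### A non-radial geodesic of the condition metric -/

section Calibration

variable {n : ℕ}

/-- The speed `s'` of the line component of a unit speed geodesic with angular momentum `1`. -/
noncomputable def lineSpeed (x : ℝ) : ℝ := Real.sqrt (1 - (warp x ^ 2)⁻¹)

theorem inv_warp_sq_pos (x : ℝ) : 0 < (warp x ^ 2)⁻¹ := by
  have := one_lt_warp x
  positivity

theorem inv_warp_sq_lt_one (x : ℝ) : (warp x ^ 2)⁻¹ < 1 :=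
  inv_lt_one_of_one_lt₀ (one_lt_pow₀ (one_lt_warp x) two_ne_zero)

theorem lineSpeed_sq (x : ℝ) : lineSpeed x ^ 2 = 1 - (warp x ^ 2)⁻¹ :=
  Real.sq_sqrt (by linarith [inv_warp_sq_lt_one x])

theorem lineSpeed_pos (x : ℝ) : 0 < lineSpeed x :=
  Real.sqrt_pos.2 (by linarith [inv_warp_sq_lt_one x])

theorem lineSpeed_le_one (x : ℝ) : lineSpeed x ≤ 1 :=
  Real.sqrt_le_one.2 (by linarith [inv_warp_sq_pos x])

theorem contDiff_lineSpeed : ContDiff ℝ 1 lineSpeed := by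
  refine ContDiff.sqrt (contDiff_const.sub (ContDiff.inv
    ((contDiff_warp.of_le (by norm_num)).pow 2) fun x => ?_)) fun x => ?_
  · have := one_lt_warp x
    positivity
  · linarith [inv_warp_sq_lt_one x]

theorem strictAnti_lineSpeed : StrictAnti lineSpeed := by
  intro x y hxy
  have h1 : warp y < warp x := strictAnti_of_deriv_neg deriv_warp_neg hxy
  have h2 := one_lt_warp y
  refine Real.sqrt_lt_sqrt (by linarith [inv_warp_sq_lt_one y]) (sub_lt_sub_left ?_ 1)
  exact (inv_lt_inv₀ (inv_pos.1 (inv_warp_sq_pos x)) (inv_pos.1 (inv_warp_sq_pos y))).2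
    (pow_lt_pow_left₀ h1 (by linarith) two_ne_zero)

/-- A primitive of `lineSpeed`. For a unit vector `e`, the function
`linePotential s + arcsin ⟪e, θ⟫` solves the eikonal equation of the condition metric where
`θ ≠ ±e`. -/
noncomputable def linePotential (x : ℝ) : ℝ := ∫ y in (0 : ℝ)..x, lineSpeed y

theorem hasDerivAt_linePotential (x : ℝ) : HasDerivAt linePotential (lineSpeed x) x :=
  (contDiff_lineSpeed.continuous.integral_hasStrictDerivAt 0 x).hasDerivAt

theorem contDiff_linePotential : ContDiff ℝ 1 linePotential := by
  rw [contDiff_one_iff_deriv]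
  refine ⟨fun x => (hasDerivAt_linePotential x).differentiableAt, ?_⟩
  rw [funext fun x => (hasDerivAt_linePotential x).deriv]
  exact contDiff_lineSpeed.continuous

theorem lipOn_of_hasDerivWithinAt {s s' : ℝ → ℝ} {a b : ℝ}
    (h : ∀ t ∈ Icc a b, HasDerivWithinAt s (s' t) (Icc a b) t) (h1 : ∀ t ∈ Icc a b, |s' t| ≤ 1) :
    LipOn s a b :=
  ⟨1, (convex_Icc a b).lipschitzOnWith_of_nnnorm_hasDerivWithin_le h fun t ht => by
    rw [← NNReal.coe_le_coe]; simpa using h1 t ht⟩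

/-- The Cauchy-Schwarz inequality behind the calibration. -/
theorem lineSpeed_mul_add_le {x u y v : ℝ} (hv : 0 ≤ v)
    (h : v ^ 2 = u ^ 2 + warp x ^ 2 * y ^ 2) : lineSpeed x * u + y ≤ v := by
  have hw := one_lt_warp x
  have h1 := lineSpeed_sq x
  refine le_of_sq_le_sq ?_ hv
  have h2 : v ^ 2 - (lineSpeed x * u + y) ^ 2
      = (lineSpeed x * (warp x * y) - (warp x)⁻¹ * u) ^ 2 := by
    have e1 : (warp x)⁻¹ * warp x = 1 := inv_mul_cancel₀ (by positivity)
    rw [← inv_pow] at h1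
    linear_combination h - (u ^ 2 + warp x ^ 2 * y ^ 2) * h1 +
      (2 * lineSpeed x * u * y + y ^ 2 * ((warp x)⁻¹ * warp x + 1)) * e1
  nlinarith [sq_nonneg (lineSpeed x * (warp x * y) - (warp x)⁻¹ * u)]

theorem inner_le_sqrt_mul_norm {e θ v : E n} (he : ‖e‖ = 1) (hθ : ‖θ‖ = 1)
    (hv : inner ℝ θ v = 0) : |inner ℝ e v| ≤ Real.sqrt (1 - inner ℝ e θ ^ 2) * ‖v‖ := by
  have h1 : inner ℝ e v = inner ℝ (e - inner ℝ e θ • θ) v := by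
    rw [inner_sub_left, inner_smul_left, hv]; simp
  have h2 : ‖e - inner ℝ e θ • θ‖ ^ 2 = 1 - inner ℝ e θ ^ 2 := by
    rw [norm_sub_sq_real, norm_smul, he, hθ, inner_smul_right, mul_one, Real.norm_eq_abs, sq_abs]
    ring
  rw [h1, ← h2, Real.sqrt_sq (norm_nonneg _)]
  exact abs_real_inner_le_norm _ _

/-- The calibration inequality: a curve that starts in the hyperplane orthogonal to `e` and has
length less than `1 / 2` is at least as long as the increment of `linePotential s + arcsin ⟪e, θ⟫`
along it. The bound on the length keeps `⟪e, θ⟫` away from the singularities `±1` of `arcsin`. -/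
theorem calibration_le_length {e : E n} (he : ‖e‖ = 1) {c : ℝ → E n} {a b : ℝ} (hab : a ≤ b)
    (hc : IsLipschitzCurve (hypSpace n \ {0}) c a b) (ha : inner ℝ e (‖c a‖⁻¹ • c a) = 0)
    (hlen : length (condFactor {0}) c a b < 1 / 2) :
    linePotential (logRadius (c b)) - linePotential (logRadius (c a)) +
      Real.arcsin (inner ℝ e (‖c b‖⁻¹ • c b)) ≤ length (condFactor {0}) c a b := by
  set σ : ℝ → ℝ := fun t => logRadius (c t) with hσdef
  set η : ℝ → E n := fun t => ‖c t‖⁻¹ • c t with hηdef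
  have hσ : LipOn σ a b := lipOn_logRadius hc
  have hη : LipOn η a b := lipOn_direction hc
  have hunit : ∀ t ∈ Icc a b, ‖η t‖ = 1 := fun t ht => norm_direction (hc.2 ht)
  set v : ℝ → ℝ := fun t => condFactor {0} (c t) * ‖deriv c t‖ with hv
  have hvE : EssBdd v a b := essBdd_speed continuousOn_condFactor_zero hc
  have hvsq := ae_condSpeed_sq hc
  have hv0 : ∀ t ∈ Icc a b, 0 ≤ v t := by
    intro t ht
    obtain ⟨h0, h1⟩ := norm_pos_and_lt_one (hc.2 ht)
    simp only [hv]
    rw [condFactor_zero (hc.2 ht)]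
    exact mul_nonneg (mul_nonneg (inv_nonneg.2 (hypRadius_pos h0 h1).le)
      (hypFactor_pos (hc.2 ht).1).le) (norm_nonneg _)
  set y : ℝ → ℝ := fun t => inner ℝ e (η t) with hy
  have hyL : LipOn y a b := hη.comp_contDiff (g := fun x => inner ℝ e x) (innerSL ℝ e).contDiff
  have hyd : ∀ᵐ t ∂(volume.restrict (Ioc a b)),
      |deriv y t| ≤ Real.sqrt (1 - y t ^ 2) * ‖deriv η t‖ := by
    filter_upwards [hη.ae_hasDerivAt, ae_mem_Ioo a b] with t h1 ht
    have h2 : HasDerivAt y (inner ℝ e (deriv η t)) t := by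
      simpa using (hasDerivAt_const t e).inner ℝ h1
    rw [h2.deriv]
    exact inner_le_sqrt_mul_norm he (hunit t (Ioo_subset_Icc_self ht))
      (inner_deriv_eq_zero_of_norm_eq_one h1
        (eventually_of_mem (Icc_mem_nhds ht.1 ht.2) hunit))
  have hηv : ∀ᵐ t ∂(volume.restrict (Ioc a b)), ‖deriv η t‖ ≤ v t := by
    filter_upwards [hvsq, ae_mem_Ioo a b] with t h1 ht
    refine le_of_sq_le_sq ?_ (hv0 t (Ioo_subset_Icc_self ht))
    simp only [hv]
    rw [h1, warpedSpeedSq]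
    have h2 := one_le_pow₀ (one_lt_warp (σ t)).le (n := 2)
    nlinarith [sq_nonneg (deriv σ t), sq_nonneg ‖deriv η t‖]
  have hybd : ∀ t ∈ Icc a b, |y t| < 1 / 2 := by
    intro t ht
    have hsub : Ioc a t ⊆ Ioc a b := Ioc_subset_Ioc_right ht.2
    have hyL' := hyL.mono le_rfl ht.2
    have hvE' : EssBdd v a t :=
      essBdd_speed continuousOn_condFactor_zero
        ⟨LipOn.mono hc.1 le_rfl ht.2, hc.2.mono_left (Icc_subset_Icc_right ht.2)⟩
    have h1 := hyL'.integral_deriv ht.1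
    have h2 : |∫ x in a..t, deriv y x| ≤ ∫ x in a..t, v x := by
      rw [← Real.norm_eq_abs]
      refine intervalIntegral.norm_integral_le_of_norm_le ht.1 ?_
        (hvE'.intervalIntegrable ht.1)
      rw [← ae_restrict_iff' measurableSet_Ioc]
      filter_upwards [ae_restrict_of_ae_restrict_of_subset hsub hyd,
        ae_restrict_of_ae_restrict_of_subset hsub hηv] with x h3 h4
      have h5 : Real.sqrt (1 - y x ^ 2) ≤ 1 := Real.sqrt_le_one.2 (by linarith [sq_nonneg (y x)])
      calc ‖deriv y x‖ ≤ Real.sqrt (1 - y x ^ 2) * ‖deriv η x‖ := h3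
        _ ≤ 1 * ‖deriv η x‖ := mul_le_mul_of_nonneg_right h5 (norm_nonneg _)
        _ ≤ v x := by rwa [one_mul]
    have h3 : ∫ x in a..t, v x ≤ ∫ x in a..b, v x := by
      refine intervalIntegral.integral_mono_interval le_rfl ht.1 ht.2 ?_
        (hvE.intervalIntegrable hab)
      filter_upwards [ae_mem_Ioo a b] with x hx using hv0 x (Ioo_subset_Icc_self hx)
    have h4 : y a = 0 := ha
    rw [h1, h4, sub_zero] at h2
    exact (h2.trans h3).trans_lt hlen
  have hAL : LipOn (fun t => Real.arcsin (y t)) a b := by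
    refine hyL.comp_contDiffAt fun t ht => ?_
    have h1 := abs_lt.1 (hybd t ht)
    exact Real.contDiffAt_arcsin (by linarith) (by linarith)
  have hPL : LipOn (fun t => linePotential (σ t)) a b := hσ.comp_contDiff contDiff_linePotential
  have h1 := hAL.integral_deriv hab
  have h2 := hPL.integral_deriv hab
  have h3 := ((EssBdd.deriv hPL).add (EssBdd.deriv hAL)).integral_mono hab hvE (by
    filter_upwards [hyd, hvsq, hσ.ae_hasDerivAt, hyL.ae_hasDerivAt, ae_mem_Ioo a b]
      with t h3 h4 h5 h6 ht
    have ht' := Ioo_subset_Icc_self ht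
    have h7 := abs_lt.1 (hybd t ht')
    have h8 : HasDerivAt (fun t => linePotential (σ t)) (lineSpeed (σ t) * deriv σ t) t :=
      (hasDerivAt_linePotential (σ t)).comp t h5
    have h9 : HasDerivAt (fun t => Real.arcsin (y t))
        (1 / Real.sqrt (1 - y t ^ 2) * deriv y t) t :=
      (Real.hasDerivAt_arcsin (by linarith) (by linarith)).comp t h6
    have h10 : 0 < Real.sqrt (1 - y t ^ 2) := Real.sqrt_pos.2 (by nlinarith)
    have h11 : 1 / Real.sqrt (1 - y t ^ 2) * deriv y t ≤ ‖deriv η t‖ := by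
      rw [one_div, inv_mul_le_iff₀ h10]
      exact (le_abs_self _).trans h3
    have h12 := lineSpeed_mul_add_le (hv0 t ht') h4
    rw [h8.deriv, h9.deriv]
    linarith)
  rw [intervalIntegral.integral_add ((EssBdd.deriv hPL).intervalIntegrable hab)
    ((EssBdd.deriv hAL).intervalIntegrable hab), h1, h2] at h3
  have h4 : y a = 0 := ha
  rw [h4, Real.arcsin_zero] at h3
  rw [length]
  linarith

/-- Polar coordinates of a geodesic with angular momentum `1`. -/
theorem exists_polar_coordinates :
    ∃ (s α : ℝ → ℝ) (h : ℝ), 0 < h ∧ h < 1 / 2 ∧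
      (∀ t ∈ Icc 0 h, HasDerivWithinAt s (lineSpeed (s t)) (Icc 0 h) t) ∧
      (∀ t ∈ Icc 0 h, HasDerivWithinAt α ((warp (s t) ^ 2)⁻¹) (Icc 0 h) t) ∧ α 0 = 0 := by
  obtain ⟨s, -, ε, hε, hs⟩ := (contDiff_lineSpeed.contDiffAt
    (x := 0)).exists_forall_mem_closedBall_exists_eq_forall_mem_Ioo_hasDerivAt₀ 0
  rw [zero_sub, zero_add] at hs
  obtain ⟨h, h0, hh⟩ := exists_between (lt_min hε (by norm_num : (0 : ℝ) < 1 / 2))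
  obtain ⟨h1, h2⟩ := lt_min_iff.1 hh
  have hsI : ∀ t ∈ Icc 0 h, HasDerivAt s (lineSpeed (s t)) t := fun t ht =>
    hs t ⟨by linarith [ht.1], ht.2.trans_lt h1⟩
  have hcont : ContinuousOn (fun t => (warp (s t) ^ 2)⁻¹) (Icc 0 h) := by
    refine ContinuousOn.inv₀ ((contDiff_warp.continuous.comp_continuousOn fun t ht =>
      (hsI t ht).continuousAt.continuousWithinAt).pow 2) fun t _ => ?_
    exact (inv_pos.1 (inv_warp_sq_pos _)).ne'
  exact ⟨s, fun t => ∫ x in (0 : ℝ)..t, (warp (s x) ^ 2)⁻¹, h, h0, h2,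
    fun t ht => (hsI t ht).hasDerivWithinAt,
    fun t ht => hasDerivWithinAt_integral_of_continuousOn h0.le hcont ht, by simp⟩

theorem logRadius_polarCurve {s : ℝ → ℝ} {θ : ℝ → E n} {t : ℝ} (hθ : ‖θ t‖ = 1) :
    logRadius (polarCurve s θ t) = s t := by
  rw [logRadius, norm_polarCurve hθ, hypRadius_tanhHalf, Real.log_exp, neg_neg]

theorem direction_polarCurve {s : ℝ → ℝ} {θ : ℝ → E n} {t : ℝ} (hθ : ‖θ t‖ = 1) :
    ‖polarCurve s θ t‖⁻¹ • polarCurve s θ t = θ t := by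
  rw [norm_polarCurve hθ, polarCurve, smul_smul,
    inv_mul_cancel₀ (tanhHalf_pos (Real.exp_pos _)).ne', one_smul]

/-- In dimension at least two there is a geodesic along which `log (1 / d(γ(t), 0))` is strictly
concave. -/
theorem exists_isMinimizingGeodesic_strictConcaveOn (hn : 2 ≤ n) :
    ∃ (γ : ℝ → E n) (h : ℝ),
      IsMinimizingGeodesic (condFactor {0}) (hypSpace n \ {0}) γ 0 h ∧
      StrictConcaveOn ℝ (Icc 0 h) (logInvDist {0} γ) := by
  obtain ⟨s, α, h, h0, hh, hs, hα, hα0⟩ := exists_polar_coordinates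
  set d : E n := EuclideanSpace.single ⟨0, by omega⟩ 1 with hd
  set e : E n := EuclideanSpace.single ⟨1, by omega⟩ 1 with he
  have hd1 : ‖d‖ = 1 := by simp [hd]
  have he1 : ‖e‖ = 1 := by simp [he]
  have hde : inner ℝ d e = 0 := by
    simp [hd, he, EuclideanSpace.inner_single_left]
  have hed : inner ℝ e d = 0 := by rw [real_inner_comm]; exact hde
  have hcirc : ∀ x y : ℝ, ‖x • d + y • e‖ ^ 2 = x ^ 2 + y ^ 2 := by
    intro x y
    rw [norm_add_sq_real, norm_smul, norm_smul, hd1, he1, inner_smul_left, inner_smul_right, hde]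
    simp
  set θ : ℝ → E n := fun t => Real.cos (α t) • d + Real.sin (α t) • e with hθdef
  have hunit : ∀ t, ‖θ t‖ = 1 := by
    intro t
    have h1 := hcirc (Real.cos (α t)) (Real.sin (α t))
    rw [Real.cos_sq_add_sin_sq] at h1
    exact (pow_eq_one_iff_of_nonneg (norm_nonneg _) two_ne_zero).1 h1
  have hin : ∀ t, inner ℝ e (θ t) = Real.sin (α t) := by
    intro t
    simp only [hθdef, inner_add_right, inner_smul_right, hed, real_inner_self_eq_norm_sq, he1]
    ring
  have hsL : LipOn s 0 h := lipOn_of_hasDerivWithinAt hs fun t _ => by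
    rw [abs_of_pos (lineSpeed_pos _)]; exact lineSpeed_le_one _
  have hαL : LipOn α 0 h := lipOn_of_hasDerivWithinAt hα fun t _ => by
    rw [abs_of_pos (inv_warp_sq_pos _)]; exact (inv_warp_sq_lt_one _).le
  have hθL : LipOn θ 0 h :=
    hαL.comp_contDiff (g := fun x => Real.cos x • d + Real.sin x • e)
      ((Real.contDiff_cos.smul contDiff_const).add (Real.contDiff_sin.smul contDiff_const))
  set γ := polarCurve s θ with hγ
  have hcurve : IsLipschitzCurve (hypSpace n \ {0}) γ 0 h :=
    isLipschitzCurve_polarCurve hsL hθL fun t _ => hunit t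
  have hspeed : ∀ t ∈ Ioo 0 h, condFactor {0} (γ t) * ‖deriv γ t‖ = 1 := by
    intro t ht
    have ht' := Ioo_subset_Icc_self ht
    have hnhds := Icc_mem_nhds ht.1 ht.2
    have h1 := (hs t ht').hasDerivAt hnhds
    have h2 := (hα t ht').hasDerivAt hnhds
    have h3 : HasDerivAt θ ((-Real.sin (α t) * (warp (s t) ^ 2)⁻¹) • d +
        (Real.cos (α t) * (warp (s t) ^ 2)⁻¹) • e) t :=
      (h2.cos.smul_const d).add (h2.sin.smul_const e)
    have h4 := condSpeed_polarCurve_sq h1 h3 (.of_forall hunit)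
    have h5 : 0 ≤ condFactor {0} (γ t) := by
      rw [hγ, condFactor_polarCurve (hunit t)]
      have := one_sub_tanhHalf_sq_pos (Real.exp (-s t))
      positivity
    have h6 : warp (s t) ^ 2 * (warp (s t) ^ 2)⁻¹ = 1 :=
      mul_inv_cancel₀ (inv_pos.1 (inv_warp_sq_pos _)).ne'
    refine (pow_eq_one_iff_of_nonneg (mul_nonneg h5 (norm_nonneg (deriv γ t)))
      two_ne_zero).1 ?_
    rw [h4, hcirc, lineSpeed_sq]
    linear_combination (warp (s t) ^ 2)⁻¹ * h6 + warp (s t) ^ 2 * (warp (s t) ^ 2)⁻¹ ^ 2 *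
      Real.sin_sq_add_cos_sq (α t)
  have harc : ∀ x y, 0 ≤ x → x ≤ y → y ≤ h → length (condFactor {0}) γ x y = y - x := by
    intro x y hx hxy hy
    have h1 : length (condFactor {0}) γ x y = ∫ _ in x..y, (1 : ℝ) := by
      refine intervalIntegral_congr_ae_restrict hxy ?_
      filter_upwards [ae_mem_Ioo x y] with t ht
      exact hspeed t ⟨hx.trans_lt ht.1, ht.2.trans_le hy⟩
    simpa using h1
  -- Along `γ`, the calibrating function grows at unit speed.
  have hpot : linePotential (s h) - linePotential (s 0) + α h = h := by
    have h1 : ∀ t ∈ Icc 0 h, HasDerivWithinAt (fun t => linePotential (s t) + α t - t) 0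
        (Icc 0 h) t := by
      intro t ht
      have h2 := ((((hasDerivAt_linePotential (s t)).comp_hasDerivWithinAt t (hs t ht)).add
        (hα t ht)).sub (hasDerivWithinAt_id t _))
      rw [← sq, lineSpeed_sq] at h2
      convert! h2 using 1
      ring
    have h2 := (convex_Icc 0 h).is_const_of_fderivWithin_eq_zero (𝕜 := ℝ)
      (fun t ht => (h1 t ht).differentiableWithinAt)
      (fun t ht => by
        rw [(h1 t ht).hasFDerivWithinAt.fderivWithin (uniqueDiffOn_Icc h0 t ht)]; simp)
      (left_mem_Icc.2 h0.le) (right_mem_Icc.2 h0.le)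
    simp only [hα0] at h2
    linarith
  have hα1 : |α h| ≤ h := by
    have := (convex_Icc 0 h).norm_image_sub_le_of_norm_hasDerivWithin_le hα
      (C := 1) (fun t _ => by
        rw [Real.norm_of_nonneg (inv_warp_sq_pos _).le]; exact (inv_warp_sq_lt_one _).le)
      (left_mem_Icc.2 h0.le) (right_mem_Icc.2 h0.le)
    simpa [hα0, abs_of_pos h0] using this
  refine ⟨γ, h, ⟨h0, hcurve, harc, fun c hc hca hcb => ?_⟩, ?_⟩
  · rw [harc 0 h le_rfl h0.le le_rfl, sub_zero]
    by_contra! hlt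
    have h1 := calibration_le_length he1 h0.le hc
      (by rw [hca, hγ, direction_polarCurve (hunit 0), hin, hα0, Real.sin_zero])
      (hlt.trans hh)
    rw [hca, hcb, hγ, logRadius_polarCurve (hunit 0), logRadius_polarCurve (hunit h),
      direction_polarCurve (hunit h), hin, Real.arcsin_sin
      (by linarith [Real.pi_gt_three, (abs_le.1 hα1).1])
      (by linarith [Real.pi_gt_three, (abs_le.1 hα1).2]), hpot] at h1
    exact absurd h1 (not_le.2 hlt)
  · have hlog : EqOn s (logInvDist {0} γ) (Icc 0 h) := fun t ht => by
      rw [logInvDist_zero (hcurve.2 ht)]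
      exact (logRadius_polarCurve (hunit t)).symm
    refine StrictConcaveOn.congr ?_ hlog
    have hder : ∀ t ∈ Ioo 0 h, deriv s t = lineSpeed (s t) := fun t ht =>
      ((hs t (Ioo_subset_Icc_self ht)).hasDerivAt (Icc_mem_nhds ht.1 ht.2)).deriv
    have hmono : StrictMonoOn s (Icc 0 h) := by
      refine strictMonoOn_of_deriv_pos (convex_Icc 0 h) hsL.continuousOn fun t ht => ?_
      rw [interior_Icc] at ht
      rw [hder t ht]
      exact lineSpeed_pos _
    refine StrictAntiOn.strictConcaveOn_of_deriv (convex_Icc 0 h) hsL.continuousOn ?_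
    rw [interior_Icc]
    intro x hx y hy hxy
    rw [hder x hx, hder y hy]
    exact strictAnti_lineSpeed (hmono (Ioo_subset_Icc_self hx) (Ioo_subset_Icc_self hy) hxy)

end Calibration

/-! ### The theorem for an arbitrary point -/

/-- If `log (1 / d(·, p))` were convex along geodesics, then, moving `p` to the centre, so it would
be along the geodesic on which it is strictly concave. -/
theorem not_selfConvex {n : ℕ} (hn : 2 ≤ n) {p : E n} (hp : p ∈ hypSpace n) :
    ¬ SelfConvex ({p} : Set (E n)) := by
  intro hconv
  obtain ⟨Φ, hΦ, hΦp⟩ := exists_isHypInvolution hp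
  have h0 : Φ 0 = p := by rw [← hΦp, hΦ.apply_apply p hp]
  have hz : (0 : E n) ∈ hypSpace n := by rw [← hΦp]; exact hΦ.mapsTo hp
  obtain ⟨γ, h, hγ, hstrict⟩ := exists_isMinimizingGeodesic_strictConcaveOn hn
  have hgeo : IsCondGeodesic {0} γ (Icc 0 h) :=
    ⟨ordConnected_Icc, fun t ht => ⟨0, h, ht, subset_rfl, self_mem_nhdsWithin, hγ⟩⟩
  have hc := hconv (fun t => Φ (γ t)) (Icc 0 h) (h0 ▸ hΦ.isCondGeodesic_comp hz hgeo)
  have hlog : EqOn (logInvDist {p} fun t => Φ (γ t)) (logInvDist {0} γ) (Icc 0 h) := fun t ht => by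
    rw [← h0]; exact hΦ.logInvDist_comp hz (hγ.curve.2 ht).1
  have hc' := hc.congr hlog
  have hl := left_mem_Icc.2 hγ.lt.le
  have hr := right_mem_Icc.2 hγ.lt.le
  have half : (0 : ℝ) < 1 / 2 := by norm_num
  have h1 := hstrict.2 hl hr hγ.lt.ne half half (by norm_num)
  have h2 := hc'.2 hl hr half.le half.le (by norm_num)
  linarith

end ConditionMetric

theorem theorem3 (n : ℕ) (p : ConditionMetric.E n) (hp : p ∈ ConditionMetric.hypSpace n) :
    (∀ (γ : ℝ → ConditionMetric.E n) (I : Set ℝ), ConditionMetric.IsCondGeodesic {p} γ I →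
      ConcaveOn ℝ I (ConditionMetric.logInvDist {p} γ) ∧
      DifferentiableOn ℝ γ I ∧
      ContDiffOn ℝ 2 (ConditionMetric.logInvDist {p} γ) I ∧
      ∀ t ∈ I, ¬ ConditionMetric.IsRadial p (γ t) (derivWithin γ I t) →
        iteratedDerivWithin 2 (ConditionMetric.logInvDist {p} γ) I t < 0 ∧
        ∃ ε : ℝ, 0 < ε ∧
          StrictConcaveOn ℝ (I ∩ Set.Ioo (t - ε) (t + ε)) (ConditionMetric.logInvDist {p} γ)) ∧
    (2 ≤ n → ¬ ConditionMetric.SelfConvex ({p} : Set (ConditionMetric.E n))) := by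
  refine ⟨fun γ I hγ => ?_, fun hn => ConditionMetric.not_selfConvex hn hp⟩
  obtain ⟨Φ, hΦ, hΦp⟩ := ConditionMetric.exists_isHypInvolution hp
  have hγ0 := hΦ.isCondGeodesic_comp hp hγ
  have hlog : EqOn (ConditionMetric.logInvDist {0} fun t => Φ (γ t))
      (ConditionMetric.logInvDist {p} γ) I := fun t ht => by
    rw [← hΦp]; exact hΦ.logInvDist_comp hp (hγ.mem ht).1
  rw [hΦp] at hγ0
  obtain ⟨h1, h2, h3, h4⟩ := hγ0.concaveOn_and_strictConcaveOn
  have hback : ∀ t ∈ I, γ t = Φ (Φ (γ t)) := fun t ht => (hΦ.apply_apply _ (hγ.mem ht).1).symm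
  have hder : ∀ t ∈ I, HasDerivWithinAt γ
      (fderiv ℝ Φ (Φ (γ t)) (derivWithin (fun t => Φ (γ t)) I t)) I t := fun t ht =>
    ((hΦ.hasFDerivAt (hγ0.mem ht).1).comp_hasDerivWithinAt t
      (h2 t ht).hasDerivWithinAt).congr hback (hback t ht)
  refine ⟨h1.congr hlog, fun t ht => (hder t ht).differentiableWithinAt,
    h3.congr fun t ht => (hlog ht).symm, fun t ht hrad => ?_⟩
  obtain ⟨h5, ε, hε, h6⟩ := h4 t ht fun h => hrad (by
    have h7 := hΦ.isRadial_apply (hγ0.mem ht).1 h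
    rw [← hback t ht, ← (hder t ht).derivWithin (hγ.uniqueDiffOn t ht)] at h7
    rwa [← hΦp, hΦ.apply_apply p hp] at h7)
  rw [iteratedDerivWithin_congr hlog ht] at h5
  exact ⟨h5, ε, hε, h6.congr fun x hx => hlog hx.1⟩
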